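/- Let $K$ be a field of characteristic $0$ and $n\ge 1$. Let $$\hat{\mathcal L}=\partial^n+v_{n-1}\partial^{n-1}+\cdots+v_1\partial ,$$ and for a covector $\xi=(\xi_1,\dots,\xi_{n-1})$ put $X_\xi=\sum_{i=1}^{n-1}\partial^{-(i+1)}\xi_i$. For pseudo-differential operators $A=\sum_i a_i\partial^i$ write $A_{\ge k}=\sum_{i\ge k}a_i\partial^i$, $A_0=a_0$ and $\operatorname{res}A=a_{-1}$, and let $D^{-1}$ denote integration, the inverse of $\partial$ on total derivatives. The second Poisson tensor is $$\hat{\mathcal P}(X)=(\hat{\mathcal L}X)_{\ge0}\hat{\mathcal L}-\hat{\mathcal L}(X\hat{\mathcal L})_{\ge1}-(X\hat{\mathcal L})_0\hat{\mathcal L}-\hat{\mathcal L}\partial^{-1}\operatorname{res}[X,\hat{\mathcal L}]-\bigl[D^{-1}\operatorname{res}[X,\hat{\mathcal L}],\hat{\mathcal L}\bigr],$$ where $\operatorname{res}[X_\xi,\hat{\mathcal L}]$ is always a total derivative. The associated bracket of functionals $F=\int f\,dx$, $G=\int g\,dx$, with densities $f,g$ that are differential polynomials in $v_1,\dots,v_{n-1}$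 over $K$, is $$\{F,G\}=\int\operatorname{res}\Bigl(\frac{\delta F}{\delta\hat{\mathcal L}}\,\hat{\mathcal P}\Bigl(\frac{\delta G}{\delta\hat{\mathcal L}}\Bigr)\Bigr)dx,\qquad \frac{\delta F}{\delta\hat{\mathcal L}}=\sum_{i=1}^{n-1}\partial^{-(i+1)}\frac{\delta F}{\delta v_i},$$ where $\int$ means the class modulo total derivatives. Let the Miura map $\hat w\mapsto v(\hat w)$ be given by the factorization $$\hat L=\hat{\mathcal L}\partial^{-1}=(\partial-\hat w_{n-1})\cdots(\partial-\hat w_1).$$ Then in the coordinates $\hat w_i$ the Poisson tensor $\hat{\mathcal P}$ is the matrix operator $-M\partial$, where $M$ is the $(n-1)\times(n-1)$ matrix with $2$ on the diagonal and $1$ everywhere else. That is, with $J$ the Fréchet derivative of $v(\hat w)$ with respect to $\hat w$ and $J^*$ its formal adjoint, at $v=v(\hat w)$ one has $$\hat{\mathcal P}(X_\xi)=\sum_{i=1}^{n-1}\bigl(J(-M\partial)J^*\xi\bigr)_i\,\partial^i$$ for all $\xi$ (with differential polynomials in $\hat w$ as components, and for every choice of the antiderivative $D^{-1}$), and for all functionals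 $F,G$ of $v$, regarded as functionals of $\hat w$, $$\{F,G\}=-\int\sum_{i,j=1}^{n-1}\frac{\delta F}{\delta\hat w_i}\,M_{ij}\,\partial\frac{\delta G}{\delta\hat w_j}\,dx .$$ -/

import Mathlib

open scoped Differential

noncomputable section

/-! ### Formal pseudo-differential operators over a commutative differential ring -/

/-- Families `(a i)` of coefficients indexed by `ℤ` that vanish for all large `i`. -/
def boundedCoeffs (R : Type*) [CommRing R] : AddSubgroup (ℤ → R) where
  carrier := {a | ∃ N : ℤ, ∀ i, N < i → a i = 0}
  zero_mem' := ⟨0, fun _ _ => rfl⟩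
  add_mem' := by
    rintro a b ⟨N, hN⟩ ⟨M, hM⟩
    refine ⟨max N M, fun i hi => ?_⟩
    rw [Pi.add_apply, hN i (lt_of_le_of_lt (le_max_left _ _) hi),
      hM i (lt_of_le_of_lt (le_max_right _ _) hi), add_zero]
  neg_mem' := by
    rintro a ⟨N, hN⟩
    exact ⟨N, fun i hi => by rw [Pi.neg_apply, hN i hi, neg_zero]⟩

/-- Formal pseudo-differential operators `∑_{i ≤ N} a_i ∂^i` with coefficients in `R`, written with
the coefficients to the left of the powers of `∂`. -/
def PDO (R : Type*) [CommRing R] : Type _ := ↥(boundedCoeffs R)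

namespace PDO

variable {R : Type*} [CommRing R]

instance : AddCommGroup (PDO R) := inferInstanceAs (AddCommGroup ↥(boundedCoeffs R))

/-- The coefficient `a_i` of `∂^i`. -/
def coeff (A : PDO R) (i : ℤ) : R := A.1 i

/-- The operator `a ∂^i`. -/
def monomial (i : ℤ) (a : R) : PDO R :=
  ⟨fun j => if j = i then a else 0, i, fun _ hj => if_neg (ne_of_gt hj)⟩

/-- The operator of multiplication by `a`. -/
def mulOp (a : R) : PDO R := monomial 0 a

/-- The operator `∂^i`, for an integer `i`. -/
def dpow (i : ℤ) : PDO R := monomial i 1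

instance : One (PDO R) := ⟨monomial 0 1⟩

/-- Composition of operators, from the generalized Leibniz rule
`a ∂^i ∘ b ∂^j = ∑_{k ≥ 0} (i choose k) a b^{(k)} ∂^{i + j - k}`. The sum below has only finitely
many nonzero terms. -/
instance [Differential R] : Mul (PDO R) where
  mul A B :=
    ⟨fun m => ∑ᶠ p : ℤ × ℕ,
        Ring.choose p.1 p.2 •
          (A.coeff p.1 * (Differential.deriv : Derivation ℤ R R)^[p.2] (B.coeff (m - p.1 + p.2))), by
      obtain ⟨N, hN⟩ := A.2
      obtain ⟨M, hM⟩ := B.2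
      refine ⟨N + M, fun m hm => finsum_eq_zero_of_forall_eq_zero fun p => ?_⟩
      rcases lt_or_ge N p.1 with h | h
      · rw [coeff, hN _ h, zero_mul, smul_zero]
      · have h0 : B.coeff (m - p.1 + p.2) = 0 := hM _ (by omega)
        rw [h0, Function.iterate_fixed (map_zero _), mul_zero, smul_zero]⟩

/-- The projection `A ↦ A_{≥ k} = ∑_{i ≥ k} a_i ∂^i`. -/
def geProj (k : ℤ) (A : PDO R) : PDO R :=
  ⟨fun i => if k ≤ i then A.coeff i else 0, by
    obtain ⟨N, hN⟩ := A.2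
    refine ⟨N, fun i hi => ?_⟩
    change (if k ≤ i then A.1 i else 0) = 0
    rw [hN i hi, ite_self]⟩

/-- The projection `A ↦ A_0` onto the term of order zero. -/
def zeroProj (A : PDO R) : PDO R := mulOp (A.coeff 0)

/-- The residue, i.e. the coefficient of `∂^{-1}`. -/
def res (A : PDO R) : R := A.coeff (-1)

end PDO

/-! ### The Lax operator and the Poisson tensor -/

section Tensor

variable {R : Type*} [CommRing R] [Differential R]

/-- The Lax operator `∂^n + v_{n-1} ∂^{n-1} + ⋯ + v_1 ∂`, where `n = m + 1` and where `v i`, for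
`i = 0, …, m - 1`, is the field `v_{i+1}`. -/
def laxOp {m : ℕ} (v : Fin m → R) : PDO R :=
  PDO.dpow (m + 1) + ∑ i : Fin m, PDO.mulOp (v i) * PDO.dpow (i + 1)

/-- The operator `∑_{i=1}^{n-1} ∂^{-(i+1)} ξ_i` attached to a covector; for `ξ_i = δH/δv_i` it is the
gradient of `H` with respect to the Lax operator. -/
def gradOp {m : ℕ} (ξ : Fin m → R) : PDO R :=
  ∑ i : Fin m, PDO.dpow (-((i : ℤ) + 2)) * PDO.mulOp (ξ i)

/-- The value of the second Poisson tensor at the Lax operator `L` on the gradient `X`, where `g`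
stands for `D⁻¹ res [X, L]`. -/
def poissonWith (L X : PDO R) (g : R) : PDO R :=
  PDO.geProj 0 (L * X) * L - L * PDO.geProj 1 (X * L) - PDO.zeroProj (X * L) * L
    - L * (PDO.dpow (-1) * PDO.mulOp (PDO.res (X * L - L * X)))
    - (PDO.mulOp g * L - L * PDO.mulOp g)

/-- The integration `D⁻¹`: some antiderivative of `f`, and `0` if there is none. -/
def antideriv (f : R) : R :=
  open Classical in if h : ∃ g : R, g′ = f then h.choose else 0

/-- The second Poisson tensor at `L` on the gradient `X`. -/
def poissonTensor (L X : PDO R) : PDO R :=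
  poissonWith L X (antideriv (PDO.res (X * L - L * X)))

/-- The product `(∂ - w_{n-1}) ⋯ (∂ - w_1)`, where `n = m + 1` and `w i` is the field `w_{i+1}`. -/
def factorOp {m : ℕ} (w : Fin m → R) : PDO R :=
  (List.ofFn fun i : Fin m => PDO.dpow 1 - PDO.mulOp (w i.rev)).prod

end Tensor

/-! ### Differential polynomials and formal variational calculus -/

/-- Differential polynomials over `K` in fields `u_i`, `i ∈ ι`; the variable with index `(i, k)` is
the `k`-th derivative of `u_i`. -/
abbrev DiffPoly (K ι : Type*) [CommRing K] : Type _ := MvPolynomial (ι × ℕ) K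

section Variational

variable {K ι : Type*} [CommRing K]

/-- The total derivative `∂ = d/dx`. -/
def totalD (K ι : Type*) [CommRing K] : Derivation K (DiffPoly K ι) (DiffPoly K ι) :=
  MvPolynomial.mkDerivation K fun p => MvPolynomial.X (p.1, p.2 + 1)

instance : Differential (DiffPoly K ι) := ⟨(totalD K ι).restrictScalars ℤ⟩

/-- Functionals: densities modulo total derivatives. -/
abbrev Functional (K ι : Type*) [CommRing K] : Type _ :=
  DiffPoly K ι ⧸ LinearMap.range (totalD K ι).toLinearMap

/-- The functional `∫ f dx` with density `f`. -/
def toFunctional : DiffPoly K ι →ₗ[K] Functional K ι :=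
  (LinearMap.range (totalD K ι).toLinearMap).mkQ

/-- The field `u_i` itself. -/
def fieldVar (i : ι) : DiffPoly K ι := MvPolynomial.X (i, 0)

/-- The variational derivative `δF/δu_i = ∑_k (-∂)^k (∂f/∂u_i^{(k)})` of `F = ∫ f dx`. -/
def varDeriv [DecidableEq ι] (f : DiffPoly K ι) (i : ι) : DiffPoly K ι :=
  ∑ᶠ k : ℕ, (-1) ^ k * (totalD K ι)^[k] (MvPolynomial.pderiv (i, k) f)

/-- The Fréchet derivative `∑_k (∂f/∂u_i^{(k)}) ∂^k` of `f` in the direction of the `i`-th field. -/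
def frechet [DecidableEq ι] (f : DiffPoly K ι) (i : ι) (η : DiffPoly K ι) : DiffPoly K ι :=
  ∑ᶠ k : ℕ, MvPolynomial.pderiv (i, k) f * (totalD K ι)^[k] η

/-- The formal adjoint `∑_k (-∂)^k ∘ (∂f/∂u_i^{(k)})` of the Fréchet derivative. -/
def frechetAdj [DecidableEq ι] (f : DiffPoly K ι) (i : ι) (ξ : DiffPoly K ι) : DiffPoly K ι :=
  ∑ᶠ k : ℕ, (-1) ^ k * (totalD K ι)^[k] (MvPolynomial.pderiv (i, k) f * ξ)

end Variational

section Miura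

variable (K : Type*) [CommRing K] {m : ℕ}

/-- The density of the bracket `{F, G} = ∫ res (δF/δL · P (δG/δL)) dx` of `F = ∫ f dx` and
`G = ∫ g dx`, functionals of the fields `v` of the Lax operator. -/
def bracketDensity (f g : DiffPoly K (Fin m)) : DiffPoly K (Fin m) :=
  PDO.res (gradOp (varDeriv f) * poissonTensor (laxOp fieldVar) (gradOp (varDeriv g)))

/-- The Miura map: the fields `v_{i+1}` as differential polynomials in the fields `w`, read off from
`∂^{n-1} + v_{n-1} ∂^{n-2} + ⋯ + v_1 = (∂ - w_{n-1}) ⋯ (∂ - w_1)`. -/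
def miura (i : Fin m) : DiffPoly K (Fin m) :=
  (factorOp (fieldVar : Fin m → DiffPoly K (Fin m))).coeff (i : ℤ)

/-- Substitution of the Miura map: from differential polynomials in `v` to those in `w`, with
`v_i^{(k)} ↦ ∂^k (v_i(w))`. -/
def miuraPullback (m : ℕ) : DiffPoly K (Fin m) →ₐ[K] DiffPoly K (Fin m) :=
  MvPolynomial.aeval fun p => (totalD K (Fin m))^[p.2] (miura K p.1)

/-- The matrix with `2` on the diagonal and `1` elsewhere. -/
def couplingMatrix (m : ℕ) : Matrix (Fin m) (Fin m) K := fun i j => if i = j then 2 else 1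

/-- The matrix operator `-M ∂`. -/
def modifiedTensor (η : Fin m → DiffPoly K (Fin m)) (i : Fin m) : DiffPoly K (Fin m) :=
  -∑ j : Fin m, couplingMatrix K m i j • totalD K (Fin m) (η j)

end Miura

end

/-! Write L = Λ∂ with Λ = ℓ_1⋯ℓ_m a product of first order factors ∂ - w, and put Y = ∂X.
Conjugation by ∂ turns the truncations of the tensor into ordinary ones: P(X) = (Ad(Y) + [Λ, q +
g])∂, where Ad(Y) = (ΛY)_{≥0}Λ - Λ(YΛ)_{≥0}, q = (XL)_0 and g = D⁻¹ res[X, L].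

For a single factor ℓ the expression (ℓZ)_{≥0}ℓ - ℓ(Zℓ)_{≥0} is the function -(res Z)′
(`firstOrder_adler`). Splitting Λ = AℓB at every factor and telescoping gives Ad(Y) = -∑ A r_p′ B
with r_p = res(BYA) (`factorOp_adler`). With S = ∑ r_p one has (S + q + g)′ = 0, so [Λ, q + g] =
-[Λ, S] = -∑ A S′ B. Hence P(X) = -∑ A (r_p′ + S′) B ∂ (`poissonWith_factorOp`): the r_p′ give the
identity part of M, the S′ its all-ones part.

Varying one w by η changes Λ by -AηB (`sum_frechet_miura`), so by cyclicity of ∫ res the components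
of J*ξ are the -r_p (`sum_frechetAdj_miura`). Together these say P = J(-M∂)J*. The bracket follows
from the chain rule for variational derivatives (`varDeriv_aeval`) and integration by parts. -/

noncomputable section

namespace PDO

/-! ### Coefficients, order filtration and truncations. -/

section Coefficients

variable {R S : Type*} [CommRing R] [CommRing S]

@[ext] theorem ext {A B : PDO R} (h : ∀ i, A.coeff i = B.coeff i) : A = B :=
  Subtype.ext (funext h)

@[simp] theorem coeff_zero (i : ℤ) : (0 : PDO R).coeff i = 0 := rfl
@[simp] theorem coeff_add (A B : PDO R) (i : ℤ) : (A + B).coeff i = A.coeff i + B.coeff i := rfl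
@[simp] theorem coeff_neg (A : PDO R) (i : ℤ) : (-A).coeff i = -A.coeff i := rfl
@[simp] theorem coeff_sub (A B : PDO R) (i : ℤ) : (A - B).coeff i = A.coeff i - B.coeff i := by
  rw [sub_eq_add_neg, coeff_add, coeff_neg, sub_eq_add_neg]

/-- The coefficient of `∂^i` as an additive map. -/
def coeffHom (i : ℤ) : PDO R →+ R where
  toFun A := A.coeff i
  map_zero' := rfl
  map_add' _ _ := rfl

theorem coeff_sum {ι : Type*} (s : Finset ι) (A : ι → PDO R) (i : ℤ) :
    (∑ x ∈ s, A x).coeff i = ∑ x ∈ s, (A x).coeff i :=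
  map_sum (coeffHom i) A s

theorem coeff_monomial (i j : ℤ) (a : R) : (monomial i a).coeff j = if j = i then a else 0 := rfl

theorem coeff_mulOp (j : ℤ) (a : R) : (mulOp a).coeff j = if j = 0 then a else 0 := rfl

theorem coeff_dpow (i j : ℤ) : (dpow i : PDO R).coeff j = if j = i then 1 else 0 := rfl

theorem one_eq_mulOp : (1 : PDO R) = mulOp 1 := rfl

theorem one_eq_dpow : (1 : PDO R) = dpow 0 := rfl

theorem coeff_geProj (k i : ℤ) (A : PDO R) :
    (geProj k A).coeff i = if k ≤ i then A.coeff i else 0 := rfl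

@[simp] theorem monomial_zero (i : ℤ) : monomial i (0 : R) = 0 := by
  ext j; simp [coeff_monomial]

theorem monomial_add (i : ℤ) (a b : R) : monomial i (a + b) = monomial i a + monomial i b := by
  ext j; simp only [coeff_add, coeff_monomial]; split_ifs <;> simp

/-- Multiplication operators as an additive map. -/
def mulOpHom : R →+ PDO R where
  toFun := mulOp
  map_zero' := monomial_zero 0
  map_add' := monomial_add 0

theorem mulOp_zero : mulOp (0 : R) = 0 := mulOpHom.map_zero
theorem mulOp_add (a b : R) : mulOp (a + b) = mulOp a + mulOp b := mulOpHom.map_add a b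
theorem mulOp_neg (a : R) : mulOp (-a) = -mulOp a := mulOpHom.map_neg a
theorem mulOp_sum {ι : Type*} (s : Finset ι) (a : ι → R) :
    mulOp (∑ x ∈ s, a x) = ∑ x ∈ s, mulOp (a x) := map_sum mulOpHom a s

/-- `A` has order at most `N`. -/
def OrderLE (N : ℤ) (A : PDO R) : Prop := ∀ i, N < i → A.coeff i = 0

theorem exists_orderLE (A : PDO R) : ∃ N, OrderLE N A := A.2

theorem OrderLE.mono {N M : ℤ} {A : PDO R} (h : OrderLE N A) (hNM : N ≤ M) : OrderLE M A :=
  fun i hi => h i (by omega)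

theorem OrderLE.sub {N : ℤ} {A B : PDO R} (hA : OrderLE N A) (hB : OrderLE N B) :
    OrderLE N (A - B) := fun i hi => by rw [coeff_sub, hA i hi, hB i hi, sub_zero]

theorem orderLE_monomial (i : ℤ) (a : R) : OrderLE i (monomial i a) :=
  fun _ hj => if_neg (ne_of_gt hj)

theorem eq_zero_of_orderLE {A : PDO R} (h : ∀ N, OrderLE N A) : A = 0 := by
  ext i; exact h (i - 1) i (by omega)

theorem exists_sum_monomial_add (A : PDO R) (k : ℤ) :
    ∃ s : Finset ℤ, OrderLE k (A - ∑ i ∈ s, monomial i (A.coeff i)) := by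
  obtain ⟨N, hN⟩ := A.exists_orderLE
  refine ⟨Finset.Ioc k N, fun j hj => ?_⟩
  rw [coeff_sub, coeff_sum]
  simp only [coeff_monomial, Finset.sum_ite_eq, Finset.mem_Ioc]
  split_ifs with h
  · simp
  · rw [hN j (by omega), sub_zero]

/-- An additive map that shifts orders by a bounded amount is determined by its values on the
operators `a ∂^i`. -/
theorem eq_zero_of_monomial (G : PDO R →+ PDO S) (c : ℤ)
    (hG : ∀ N A, OrderLE N A → OrderLE (N + c) (G A)) (h : ∀ i a, G (monomial i a) = 0)
    (A : PDO R) : G A = 0 := by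
  refine eq_zero_of_orderLE fun N => ?_
  -- Truncating at N - c leaves a tail whose image has order at most N.
  obtain ⟨s, hs⟩ := A.exists_sum_monomial_add (N - c)
  have h1 := hG _ _ hs
  rw [map_sub, map_sum, Finset.sum_eq_zero fun i _ => h i _, sub_zero] at h1
  simpa using h1

/-- Multiplication by a fixed operator shifts orders boundedly, so this reduces associativity to
monomials despite the infinite tails. -/
theorem eq_of_monomial (G H : PDO R →+ PDO S) (c : ℤ)
    (hG : ∀ N A, OrderLE N A → OrderLE (N + c) (G A))
    (hH : ∀ N A, OrderLE N A → OrderLE (N + c) (H A))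
    (h : ∀ i a, G (monomial i a) = H (monomial i a)) (A : PDO R) : G A = H A :=
  sub_eq_zero.1 (eq_zero_of_monomial (G - H) c
    (fun N A hA => (hG N A hA).sub (hH N A hA)) (fun i a => sub_eq_zero.2 (h i a)) A)

/-- `A` has no terms of negative order. -/
def IsDifferential (A : PDO R) : Prop := ∀ i < 0, A.coeff i = 0

theorem IsDifferential.sub {A B : PDO R} (hA : IsDifferential A) (hB : IsDifferential B) :
    IsDifferential (A - B) := fun i hi => by rw [coeff_sub, hA i hi, hB i hi, sub_zero]

theorem isDifferential_monomial {i : ℤ} (hi : 0 ≤ i) (a : R) : IsDifferential (monomial i a) :=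
  fun _ hj => if_neg (by omega)

theorem isDifferential_geProj (A : PDO R) : IsDifferential (geProj 0 A) :=
  fun _ hj => if_neg (by omega)

theorem orderLE_sub_geProj (A : PDO R) : OrderLE (-1) (A - geProj 0 A) := fun i hi => by
  rw [coeff_sub, coeff_geProj, if_pos (by omega), sub_self]

theorem res_add (A B : PDO R) : res (A + B) = res A + res B := rfl

theorem res_sub (A B : PDO R) : res (A - B) = res A - res B := coeff_sub A B _

end Coefficients

/-! ### The ring of pseudo-differential operators. -/

section Ring

variable {R : Type*} [CommRing R] [Differential R]

theorem coeff_mul (A B : PDO R) (m : ℤ) :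
    (A * B).coeff m = ∑ᶠ p : ℤ × ℕ, Ring.choose p.1 p.2 •
      (A.coeff p.1 * (Differential.deriv : Derivation ℤ R R)^[p.2] (B.coeff (m - p.1 + p.2))) :=
  rfl

theorem iterate_deriv_zero (k : ℕ) : (Differential.deriv : Derivation ℤ R R)^[k] 0 = 0 :=
  Function.iterate_fixed (map_zero _) k

theorem iterate_deriv_add (k : ℕ) (a b : R) :
    (Differential.deriv : Derivation ℤ R R)^[k] (a + b) =
      (Differential.deriv : Derivation ℤ R R)^[k] a +
        (Differential.deriv : Derivation ℤ R R)^[k] b :=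
  iterate_map_add _ k a b

theorem iterate_deriv_one {k : ℕ} (hk : k ≠ 0) :
    (Differential.deriv : Derivation ℤ R R)^[k] 1 = 0 := by
  obtain ⟨l, rfl⟩ := Nat.exists_eq_succ_of_ne_zero hk
  rw [Function.iterate_succ_apply, Derivation.map_one_eq_zero, iterate_deriv_zero]

theorem finite_support_mul (A B : PDO R) (m : ℤ) :
    (Function.support fun p : ℤ × ℕ => Ring.choose p.1 p.2 •
      (A.coeff p.1 * (Differential.deriv : Derivation ℤ R R)^[p.2]
        (B.coeff (m - p.1 + p.2)))).Finite := by
  obtain ⟨N, hN⟩ := A.exists_orderLE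
  obtain ⟨M, hM⟩ := B.exists_orderLE
  refine Set.Finite.subset
    (Finset.Icc (m - M) N ×ˢ Finset.range (M + N - m + 1).toNat).finite_toSet fun p hp => ?_
  rw [Function.mem_support] at hp
  have h1 : p.1 ≤ N := by
    by_contra! h
    exact hp (by rw [hN _ h, zero_mul, smul_zero])
  have h2 : m - p.1 + p.2 ≤ M := by
    by_contra! h
    exact hp (by rw [hM _ h, iterate_deriv_zero, mul_zero, smul_zero])
  simp only [Finset.coe_product, Set.mem_prod, Finset.mem_coe, Finset.mem_Icc, Finset.mem_range]
  omega

theorem OrderLE.mul {N M : ℤ} {A B : PDO R} (hA : OrderLE N A) (hB : OrderLE M B) :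
    OrderLE (N + M) (A * B) := fun m hm => by
  refine finsum_eq_zero_of_forall_eq_zero fun p => ?_
  rcases lt_or_ge N p.1 with h | h
  · rw [hA _ h, zero_mul, smul_zero]
  · rw [hB (m - p.1 + p.2) (by omega), iterate_deriv_zero, mul_zero, smul_zero]

scoped instance : NonUnitalNonAssocRing (PDO R) where
  __ := (inferInstance : AddCommGroup (PDO R))
  mul A B := A * B
  left_distrib A B C := by
    ext m
    change (A * (B + C)).coeff m = (A * B).coeff m + (A * C).coeff m
    rw [coeff_mul, coeff_mul, coeff_mul,
      ← finsum_add_distrib (finite_support_mul A B m) (finite_support_mul A C m)]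
    refine finsum_congr fun p => ?_
    rw [← smul_add, ← mul_add, ← iterate_deriv_add, coeff_add]
  right_distrib A B C := by
    ext m
    change ((A + B) * C).coeff m = (A * C).coeff m + (B * C).coeff m
    rw [coeff_mul, coeff_mul, coeff_mul,
      ← finsum_add_distrib (finite_support_mul A C m) (finite_support_mul B C m)]
    refine finsum_congr fun p => ?_
    rw [← smul_add, ← add_mul, coeff_add]
  zero_mul A := by
    ext m
    refine finsum_eq_zero_of_forall_eq_zero fun p => ?_
    rw [coeff_zero, zero_mul, smul_zero]
  mul_zero A := by
    ext m
    refine finsum_eq_zero_of_forall_eq_zero fun p => ?_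
    rw [coeff_zero, iterate_deriv_zero, mul_zero, smul_zero]

theorem coeff_monomial_mul_monomial (i j : ℤ) (a b : R) (m : ℤ) :
    (monomial i a * monomial j b).coeff m =
      if m ≤ i + j then Ring.choose i (i + j - m).toNat •
        (a * (Differential.deriv : Derivation ℤ R R)^[(i + j - m).toNat] b) else 0 := by
  rw [coeff_mul]
  split_ifs with h
  · rw [finsum_eq_single _ (i, (i + j - m).toNat)]
    · simp only [coeff_monomial, if_true]
      rw [if_pos (by omega)]
    · rintro ⟨x, y⟩ hp
      simp only [coeff_monomial]
      split_ifs with h1 h2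
      · exact absurd (Prod.ext h1 (show y = _ by omega)) hp
      · rw [iterate_deriv_zero, mul_zero, smul_zero]
      all_goals rw [zero_mul, smul_zero]
  · refine finsum_eq_zero_of_forall_eq_zero fun p => ?_
    simp only [coeff_monomial]
    split_ifs with h1 h2
    · omega
    · rw [iterate_deriv_zero, mul_zero, smul_zero]
    all_goals rw [zero_mul, smul_zero]

theorem coeff_mulOp_mul (a : R) (A : PDO R) (m : ℤ) : (mulOp a * A).coeff m = a * A.coeff m := by
  rw [coeff_mul, finsum_eq_single _ (0, 0)]
  · simp [coeff_mulOp]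
  · rintro ⟨x, y⟩ hp
    simp only [coeff_mulOp]
    split_ifs with h
    · subst h
      rw [Ring.choose_zero_pos ℤ (Nat.pos_of_ne_zero fun h => hp (by rw [h])), zero_smul]
    · rw [zero_mul, smul_zero]

theorem coeff_mul_dpow (A : PDO R) (j m : ℤ) : (A * dpow j).coeff m = A.coeff (m - j) := by
  rw [coeff_mul, finsum_eq_single _ (m - j, 0)]
  · simp [coeff_dpow]
  · rintro ⟨x, y⟩ hp
    simp only [coeff_dpow]
    split_ifs with h
    · rw [iterate_deriv_one, mul_zero, smul_zero]
      rintro rfl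
      exact hp (Prod.ext (show x = m - j by push_cast at h; omega) rfl)
    · rw [iterate_deriv_zero, mul_zero, smul_zero]

theorem coeff_dpow_one_mul (A : PDO R) (m : ℤ) :
    (dpow 1 * A).coeff m = A.coeff (m - 1) + (A.coeff m)′ := by
  have hne : ((1, 0) : ℤ × ℕ) ≠ (1, 1) := by simp
  rw [coeff_mul, finsum_eq_sum_of_support_subset (s := {(1, 0), (1, 1)}), Finset.sum_pair hne]
  · simp [coeff_dpow]
  · rintro ⟨x, y⟩ hp
    rw [Function.mem_support] at hp
    simp only [coeff_dpow] at hp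
    split_ifs at hp with h
    · subst h
      have h2 : Ring.choose (1 : ℤ) y = Nat.choose 1 y := by
        simpa using Ring.choose_natCast (R := ℤ) 1 y
      rw [h2] at hp
      have h3 : y ≤ 1 := by
        by_contra! h
        exact hp (by rw [Nat.choose_eq_zero_of_lt h, Nat.cast_zero, zero_smul])
      interval_cases y <;> simp
    · exact absurd (by rw [zero_mul, smul_zero]) hp

/-- A term a_z ∂^z with z ≥ 0 would contribute with k = z + 1 derivatives, and the binomial (z
choose z + 1) vanishes. -/
theorem coeff_mul_mulOp_neg_one (A : PDO R) (a : R) :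
    (A * mulOp a).coeff (-1) = A.coeff (-1) * a := by
  rw [coeff_mul, finsum_eq_single _ (-1, 0)]
  · simp [coeff_mulOp]
  · rintro ⟨x, y⟩ hp
    simp only [coeff_mulOp]
    split_ifs with h
    · have hy : y ≠ 0 := fun h0 => hp (Prod.ext (show x = -1 by omega) h0)
      obtain ⟨z, rfl⟩ := Nat.exists_eq_succ_of_ne_zero hy
      obtain rfl : x = z := by push_cast at h; omega
      have h2 : Ring.choose (z : ℤ) (z + 1) = 0 := by
        simpa using Ring.choose_natCast (R := ℤ) z (z + 1)
      rw [h2, zero_smul]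
    · rw [iterate_deriv_zero, mul_zero, smul_zero]

theorem mulOp_mul_dpow (i : ℤ) (a : R) : mulOp a * dpow i = monomial i a := by
  ext m; rw [coeff_mulOp_mul, coeff_dpow, coeff_monomial, mul_ite, mul_one, mul_zero]

theorem dpow_one_mul_dpow (i : ℤ) : (dpow 1 * dpow i : PDO R) = dpow (i + 1) := by
  ext m
  rw [coeff_mul_dpow, coeff_dpow, coeff_dpow]
  exact if_congr (by omega) rfl rfl

theorem dpow_one_mul_monomial (i : ℤ) (a : R) :
    dpow 1 * monomial i a = monomial (i + 1) a + monomial i a′ := by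
  ext m
  rw [coeff_dpow_one_mul, coeff_add, coeff_monomial, coeff_monomial, coeff_monomial, coeff_monomial]
  congr 1
  · exact if_congr (by omega) rfl rfl
  · split_ifs <;> simp

/-- If A has order at most d, the coefficient of ∂^{d+1} in ∂A is a_d, so the bound on the order
drops forever. -/
theorem dpow_one_mul_eq_zero {A : PDO R} (h : dpow 1 * A = 0) : A = 0 := by
  obtain ⟨N, hN⟩ := A.exists_orderLE
  refine eq_zero_of_orderLE fun M => ?_
  suffices ∀ k : ℕ, OrderLE (N - k) A from
    (this (N - M).toNat).mono (by omega)
  intro k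
  induction k with
  | zero => simpa using hN
  | succ k ih =>
    intro i hi
    push_cast at hi
    have h1 : (dpow 1 * A).coeff (i + 1) = 0 := by rw [h]; rfl
    rw [coeff_dpow_one_mul, ih (i + 1) (by omega), map_zero, add_zero] at h1
    simpa using h1

theorem dpow_one_mul_injective {A B : PDO R} (h : dpow 1 * A = dpow 1 * B) : A = B :=
  sub_eq_zero.1 (dpow_one_mul_eq_zero (by rw [mul_sub, h, sub_self]))

/-- Pascal's rule for generalized binomials combined with the Leibniz rule; the order i + j + 1 is
separate because only the leading term reaches it. -/
theorem dpow_one_mul_assoc_monomial (i j : ℤ) (a b : R) :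
    dpow 1 * monomial i a * monomial j b = dpow 1 * (monomial i a * monomial j b) := by
  rw [dpow_one_mul_monomial, add_mul]
  ext m
  simp only [coeff_add, coeff_dpow_one_mul, coeff_monomial_mul_monomial]
  rcases lt_trichotomy m (i + j + 1) with h | h | h
  · obtain ⟨k, rfl⟩ : ∃ k : ℕ, m = i + j - k := ⟨(i + j - m).toNat, by omega⟩
    rw [if_pos (by omega), if_pos (by omega), if_pos (by omega), if_pos (by omega),
      show (i + 1 + j - (i + j - (k : ℤ))).toNat = k + 1 by omega,
      show (i + j - (i + j - (k : ℤ))).toNat = k by omega,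
      show (i + j - (i + j - (k : ℤ) - 1)).toNat = k + 1 by omega,
      Ring.choose_succ_succ, map_zsmul, Derivation.leibniz, Function.iterate_succ_apply']
    simp only [zsmul_eq_mul, smul_eq_mul, Int.cast_add]
    ring
  · subst h
    rw [if_pos (by omega), if_neg (by omega), if_pos (by omega),
      show (i + 1 + j - (i + j + 1)).toNat = 0 by omega,
      show (i + j - (i + j + 1 - 1)).toNat = 0 by omega]
    simp
  · rw [if_neg (by omega), if_neg (by omega), if_neg (by omega), if_neg (by omega)]
    simp

theorem dpow_one_mul_assoc (B C : PDO R) : dpow 1 * B * C = dpow 1 * (B * C) := by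
  obtain ⟨M, hM⟩ := C.exists_orderLE
  have h1 : OrderLE 1 (dpow 1 : PDO R) := orderLE_monomial 1 1
  refine eq_of_monomial ((AddMonoidHom.mulRight C).comp (AddMonoidHom.mulLeft (dpow 1)))
    ((AddMonoidHom.mulLeft (dpow 1)).comp (AddMonoidHom.mulRight C)) (1 + M)
    (fun N A hA => ((h1.mul hA).mul hM).mono (by omega))
    (fun N A hA => (h1.mul (hA.mul hM)).mono (by omega)) (fun i a => ?_) B
  refine eq_of_monomial (AddMonoidHom.mulLeft (dpow 1 * monomial i a))
    ((AddMonoidHom.mulLeft (dpow 1)).comp (AddMonoidHom.mulLeft (monomial i a))) (1 + i)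
    (fun N A hA => ((h1.mul (orderLE_monomial i a)).mul hA).mono (by omega))
    (fun N A hA => (h1.mul ((orderLE_monomial i a).mul hA)).mono (by omega)) (fun j b => ?_) C
  exact dpow_one_mul_assoc_monomial i j a b

theorem mulOp_mul_assoc (a : R) (B C : PDO R) : mulOp a * B * C = mulOp a * (B * C) := by
  ext m
  rw [coeff_mulOp_mul, coeff_mul, coeff_mul, ← AddMonoidHom.coe_mulLeft a,
    AddMonoidHom.map_finsum _ (finite_support_mul B C m)]
  refine finsum_congr fun p => ?_
  rw [coeff_mulOp_mul, AddMonoidHom.coe_mulLeft, mul_smul_comm, mul_assoc]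

protected theorem one_mul (A : PDO R) : 1 * A = A := by
  ext m; rw [one_eq_mulOp, coeff_mulOp_mul, _root_.one_mul]

protected theorem mul_one (A : PDO R) : A * 1 = A := by
  ext m; rw [one_eq_dpow, coeff_mul_dpow, sub_zero]

theorem dpow_mul_assoc (i : ℤ) (B C : PDO R) : dpow i * B * C = dpow i * (B * C) := by
  induction i using Int.induction_on generalizing B C with
  | zero => rw [← one_eq_dpow, PDO.one_mul, PDO.one_mul]
  | succ i ih => rw [← dpow_one_mul_dpow, dpow_one_mul_assoc, dpow_one_mul_assoc, ih,
      dpow_one_mul_assoc]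
  -- Negative powers follow by cancelling ∂ on the left, which avoids a Vandermonde identity for
  -- generalized binomials.
  | pred i ih =>
    have h (A : PDO R) : dpow 1 * (dpow (-(i : ℤ) - 1) * A) = dpow (-(i : ℤ)) * A := by
      rw [← dpow_one_mul_assoc, dpow_one_mul_dpow, sub_add_cancel]
    apply dpow_one_mul_injective
    rw [← dpow_one_mul_assoc, h, h, ih]

theorem monomial_mul_assoc (i : ℤ) (a : R) (B C : PDO R) :
    monomial i a * B * C = monomial i a * (B * C) := by
  rw [← mulOp_mul_dpow, mulOp_mul_assoc, mulOp_mul_assoc, dpow_mul_assoc, mulOp_mul_assoc]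

protected theorem mul_assoc (A B C : PDO R) : A * B * C = A * (B * C) := by
  obtain ⟨M, hM⟩ := B.exists_orderLE
  obtain ⟨P, hP⟩ := C.exists_orderLE
  exact eq_of_monomial ((AddMonoidHom.mulRight C).comp (AddMonoidHom.mulRight B))
    (AddMonoidHom.mulRight (B * C)) (M + P)
    (fun N A hA => ((hA.mul hM).mul hP).mono (by omega))
    (fun N A hA => (hA.mul (hM.mul hP)).mono (by omega))
    (fun i a => monomial_mul_assoc i a B C) A

scoped instance : Ring (PDO R) where
  __ := (inferInstance : NonUnitalNonAssocRing (PDO R))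
  one := 1
  one_mul := PDO.one_mul
  mul_one := PDO.mul_one
  mul_assoc := PDO.mul_assoc

end Ring

end PDO

/-! ### Telescoping over an ordered product. -/

section FactorProducts

variable {A : Type*} {m : ℕ}

/-- The product of the first `p` factors of `f 0 * ⋯ * f (m - 1)`. -/
def leftProd [Monoid A] (f : Fin m → A) (p : ℕ) : A := ((List.ofFn f).take p).prod

/-- The product of all but the first `p` factors of `f 0 * ⋯ * f (m - 1)`. -/
def rightProd [Monoid A] (f : Fin m → A) (p : ℕ) : A := ((List.ofFn f).drop p).prod

theorem leftProd_zero [Monoid A] (f : Fin m → A) : leftProd f 0 = 1 := by simp [leftProd]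

theorem rightProd_zero [Monoid A] (f : Fin m → A) : rightProd f 0 = (List.ofFn f).prod := by
  simp [rightProd]

theorem leftProd_length [Monoid A] (f : Fin m → A) : leftProd f m = (List.ofFn f).prod := by
  rw [leftProd, List.take_of_length_le (by simp)]

theorem rightProd_length [Monoid A] (f : Fin m → A) : rightProd f m = 1 := by
  rw [rightProd, List.drop_of_length_le (by simp), List.prod_nil]

theorem leftProd_succ [Monoid A] (f : Fin m → A) (p : Fin m) :
    leftProd f (p + 1) = leftProd f p * f p := by
  rw [leftProd, List.prod_take_succ _ _ (by simp), List.getElem_ofFn, leftProd]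

theorem rightProd_eq_mul [Monoid A] (f : Fin m → A) (p : Fin m) :
    rightProd f p = f p * rightProd f (p + 1) := by
  rw [rightProd, List.drop_eq_getElem_cons (by simp), List.prod_cons, List.getElem_ofFn, rightProd]

theorem sum_fin_telescope [AddCommGroup A] (u : ℕ → A) :
    ∑ p : Fin m, (u p - u (p + 1)) = u 0 - u m := by
  rw [Fin.sum_univ_eq_sum_range (fun p => u p - u (p + 1)), Finset.sum_range_sub']

/-- The Leibniz rule for a product of factors. -/
theorem leibniz_prod_ofFn [Ring A] (D : A →+ A) (hD : ∀ a b, D (a * b) = D a * b + a * D b)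
    (f : Fin m → A) :
    D (List.ofFn f).prod = ∑ p : Fin m, leftProd f p * D (f p) * rightProd f (p + 1) := by
  -- With B = ℓB', the Leibniz rule gives A D(B) - Aℓ D(B') = A D(ℓ) B'.
  have hU (p : Fin m) : leftProd f p * D (f p) * rightProd f (p + 1) =
      leftProd f p * D (rightProd f p) - leftProd f (p + 1) * D (rightProd f (p + 1)) := by
    rw [rightProd_eq_mul, hD, leftProd_succ]
    noncomm_ring
  have h1 : D 1 = 0 := by simpa using hD 1 1
  rw [Finset.sum_congr rfl fun p _ => hU p,
    sum_fin_telescope fun p => leftProd f p * D (rightProd f p), leftProd_zero, rightProd_zero,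
    rightProd_length, h1, one_mul, mul_zero, sub_zero]

end FactorProducts

/-! ### Differential operators and elementary commutation rules. -/

namespace PDO

variable {R : Type*} [CommRing R] [Differential R]

theorem IsDifferential.mul {A B : PDO R} (hA : IsDifferential A) (hB : IsDifferential B) :
    IsDifferential (A * B) := fun m hm => by
  refine finsum_eq_zero_of_forall_eq_zero fun p => ?_
  rcases lt_or_ge p.1 0 with h | h
  · rw [hA _ h, zero_mul, smul_zero]
  rcases lt_or_ge (m - p.1 + p.2) 0 with h' | h'
  · rw [hB _ h', iterate_deriv_zero, mul_zero, smul_zero]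
  obtain ⟨i, hi⟩ := Int.eq_ofNat_of_zero_le h
  have h2 : Ring.choose p.1 p.2 = 0 := by
    rw [hi]
    have := Ring.choose_natCast (R := ℤ) i p.2
    rw [Nat.choose_eq_zero_of_lt (by omega), Nat.cast_zero] at this
    simpa using this
  rw [h2, zero_smul]

theorem mulOp_mul_mulOp (a b : R) : mulOp a * mulOp b = mulOp (a * b) := by
  ext m; rw [coeff_mulOp_mul, coeff_mulOp, coeff_mulOp, mul_ite, mul_zero]

theorem dpow_one_mul_mulOp (a : R) : dpow 1 * mulOp a = mulOp a * dpow 1 + mulOp a′ := by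
  rw [mulOp_mul_dpow, mulOp, dpow_one_mul_monomial, zero_add, mulOp]

theorem dpow_mul_dpow (i j : ℤ) : (dpow i * dpow j : PDO R) = dpow (i + j) := by
  ext m
  rw [coeff_mul_dpow, coeff_dpow, coeff_dpow]
  exact if_congr (by omega) rfl rfl

theorem dpow_natCast (k : ℕ) : (dpow (k : ℤ) : PDO R) = dpow 1 ^ k := by
  induction k with
  | zero => rfl
  | succ k ih => rw [pow_succ', ← ih, dpow_mul_dpow, Nat.cast_succ, add_comm]

/-! ### Residues of commutators -/

theorem res_mulOp_mul (a : R) (A : PDO R) : res (mulOp a * A) = a * res A := coeff_mulOp_mul a A _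

theorem res_mul_mulOp (a : R) (A : PDO R) : res (A * mulOp a) = res A * a :=
  coeff_mul_mulOp_neg_one A a

theorem res_dpow_one_mul (A : PDO R) : res (dpow 1 * A) = res (A * dpow 1) + (res A)′ := by
  rw [res, res, res, coeff_dpow_one_mul, coeff_mul_dpow]

/-- Functions may be moved cyclically under the residue, so only ∂ contributes. -/
theorem res_firstOrder_commutator (a : R) (Z : PDO R) :
    res ((dpow 1 - mulOp a) * Z) - res (Z * (dpow 1 - mulOp a)) = (res Z)′ := by
  rw [sub_mul, mul_sub, res_sub, res_sub, res_dpow_one_mul, res_mulOp_mul, res_mul_mulOp]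
  ring

variable (R) in
/-- The operators whose commutators with all operators have a total derivative as residue. -/
def exactResidue : Subring (PDO R) where
  carrier := {L | ∀ X, ∃ g : R, g′ = res (X * L - L * X)}
  -- [X, BC] = [XB, C] + [CX, B]. Closure under products reduces exactness to the generators ∂ and
  -- functions.
  mul_mem' {B C} hB hC X := by
    obtain ⟨g, hg⟩ := hC (X * B)
    obtain ⟨h, hh⟩ := hB (C * X)
    refine ⟨g + h, ?_⟩
    rw [map_add, hg, hh, ← res_add]
    congr 1
    noncomm_ring
  one_mem' X := ⟨0, by rw [mul_one, one_mul, sub_self, map_zero]; rfl⟩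
  add_mem' {B C} hB hC X := by
    obtain ⟨g, hg⟩ := hB X
    obtain ⟨h, hh⟩ := hC X
    refine ⟨g + h, ?_⟩
    rw [map_add, hg, hh, ← res_add]
    congr 1
    noncomm_ring
  zero_mem' X := ⟨0, by rw [mul_zero, zero_mul, sub_self, map_zero]; rfl⟩
  neg_mem' {B} hB X := by
    obtain ⟨g, hg⟩ := hB (-X)
    exact ⟨g, by rw [hg, neg_mul_comm, neg_mul_comm]⟩

theorem mulOp_mem_exactResidue (a : R) : mulOp a ∈ exactResidue R := fun X =>
  ⟨0, by rw [res_sub, res_mulOp_mul, res_mul_mulOp, mul_comm, sub_self, map_zero]⟩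

theorem dpow_one_mem_exactResidue : dpow 1 ∈ exactResidue R := fun X =>
  ⟨-res X, by rw [res_sub, res_dpow_one_mul, map_neg]; ring⟩

theorem laxOp_mem_exactResidue {m : ℕ} (v : Fin m → R) : laxOp v ∈ exactResidue R := by
  have h (k : ℕ) : dpow (k + 1 : ℤ) ∈ exactResidue R := by
    rw [← Nat.cast_succ, dpow_natCast]
    exact pow_mem dpow_one_mem_exactResidue _
  exact add_mem (h m) (sum_mem fun i _ => mul_mem (mulOp_mem_exactResidue _) (h i))

/-! ### The Poisson tensor at a factorized Lax operator -/

/-- The left side is a differential operator. Since (ℓZ)ℓ = ℓ(Zℓ), it also equals ℓ(Zℓ)_{<0} -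
(ℓZ)_{<0}ℓ, which has order at most 0; so it is the function res(Zℓ) - res(ℓZ). -/
theorem firstOrder_adler (a : R) (Z : PDO R) :
    geProj 0 ((dpow 1 - mulOp a) * Z) * (dpow 1 - mulOp a) -
      (dpow 1 - mulOp a) * geProj 0 (Z * (dpow 1 - mulOp a)) = mulOp (-(res Z)′) := by
  have hl : IsDifferential (dpow 1 - mulOp a) :=
    (isDifferential_monomial zero_le_one 1).sub (isDifferential_monomial le_rfl a)
  have hl' : OrderLE 1 (dpow 1 - mulOp a) :=
    (orderLE_monomial 1 1).sub ((orderLE_monomial 0 a).mono zero_le_one)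
  have hU := orderLE_sub_geProj ((dpow 1 - mulOp a) * Z)
  have hV := orderLE_sub_geProj (Z * (dpow 1 - mulOp a))
  have hres := res_firstOrder_commutator a Z
  set P := (dpow 1 - mulOp a) * Z with hP
  set Q := Z * (dpow 1 - mulOp a) with hQ
  have key : geProj 0 P * (dpow 1 - mulOp a) - (dpow 1 - mulOp a) * geProj 0 Q =
      (dpow 1 - mulOp a) * (Q - geProj 0 Q) - (P - geProj 0 P) * (dpow 1 - mulOp a) := by
    rw [mul_sub, sub_mul, hP, hQ]
    noncomm_ring
  ext i
  rw [coeff_mulOp]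
  rcases lt_trichotomy i 0 with h | h | h
  · rw [if_neg h.ne]
    exact ((isDifferential_geProj P).mul hl).sub (hl.mul (isDifferential_geProj Q)) i h
  · subst h
    have h1 : ((P - geProj 0 P) * mulOp a).coeff 0 = 0 :=
      hU.mul (orderLE_monomial 0 a) 0 (by norm_num)
    have h2 : ((dpow 1 - mulOp a) * (Q - geProj 0 Q)).coeff 0 = Q.coeff (-1) := by
      rw [sub_mul, coeff_sub, coeff_dpow_one_mul, coeff_mulOp_mul, hV 0 (by norm_num), map_zero,
        coeff_sub, coeff_geProj, if_neg (by norm_num)]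
      simp
    have h3 : ((P - geProj 0 P) * (dpow 1 - mulOp a)).coeff 0 = P.coeff (-1) := by
      rw [mul_sub, coeff_sub, h1, coeff_mul_dpow, coeff_sub, coeff_geProj, if_neg (by norm_num)]
      simp
    rw [if_pos rfl, key, coeff_sub, h2, h3, ← hres, res, res, neg_sub]
  · rw [if_neg h.ne', key]
    exact ((hl'.mul hV).sub ((hU.mul hl').mono (by norm_num))) i (by omega)

variable {m : ℕ}

/-- The factors of `factorOp w`, from left to right. -/
def factors (w : Fin m → R) (p : Fin m) : PDO R := dpow 1 - mulOp (w p.rev)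

theorem factorOp_eq (w : Fin m → R) : factorOp w = (List.ofFn (factors w)).prod := rfl

/-- The residue `res (B Y A)` for the splitting `A ℓ B` of `factorOp w` at its `p`-th factor `ℓ`. -/
def splitRes (w : Fin m → R) (Y : PDO R) (p : Fin m) : R :=
  res (rightProd (factors w) (p + 1) * Y * leftProd (factors w) p)

theorem deriv_splitRes (w : Fin m → R) (Y : PDO R) (p : Fin m) :
    (splitRes w Y p)′ =
      res (rightProd (factors w) p * Y * leftProd (factors w) p) -
      res (rightProd (factors w) (p + 1) * Y * leftProd (factors w) (p + 1)) := by
  rw [splitRes, ← res_firstOrder_commutator (w p.rev), ← factors, leftProd_succ,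
    rightProd_eq_mul (factors w) p]
  simp only [mul_assoc]

theorem deriv_sum_splitRes (w : Fin m → R) (Y : PDO R) :
    (∑ p, splitRes w Y p)′ = res (factorOp w * Y) - res (Y * factorOp w) := by
  rw [map_sum, Finset.sum_congr rfl fun p _ => deriv_splitRes w Y p, sum_fin_telescope fun p =>
    res (rightProd (factors w) p * Y * leftProd (factors w) p), leftProd_zero, rightProd_zero,
    rightProd_length, leftProd_length, mul_one, one_mul, factorOp_eq]

/-- The quadratic bracket of a product of first order factors is diagonal. -/
theorem factorOp_adler (w : Fin m → R) (Y : PDO R) :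
    geProj 0 (factorOp w * Y) * factorOp w - factorOp w * geProj 0 (Y * factorOp w) =
      -∑ p : Fin m, leftProd (factors w) p * mulOp (splitRes w Y p)′ *
        rightProd (factors w) (p + 1) := by
  -- Multiply the one-factor identity for Z = BYA by A on the left and B on the right; the result is
  -- a difference of consecutive terms.
  have hU (p : Fin m) : leftProd (factors w) p * mulOp (splitRes w Y p)′ *
        rightProd (factors w) (p + 1) =
      -(leftProd (factors w) p *
          geProj 0 (rightProd (factors w) p * Y * leftProd (factors w) p) *
            rightProd (factors w) p -
        leftProd (factors w) (p + 1) *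
          geProj 0 (rightProd (factors w) (p + 1) * Y * leftProd (factors w) (p + 1)) *
            rightProd (factors w) (p + 1)) := by
    have h := firstOrder_adler (w p.rev)
      (rightProd (factors w) (p + 1) * Y * leftProd (factors w) p)
    rw [← factors, ← splitRes, mulOp_neg] at h
    rw [← neg_eq_iff_eq_neg.2 h.symm.symm, rightProd_eq_mul (factors w) p, leftProd_succ]
    simp only [mul_assoc]
    noncomm_ring
  rw [Finset.sum_congr rfl fun p _ => hU p, Finset.sum_neg_distrib, neg_neg, sum_fin_telescope
    fun p => leftProd (factors w) p *
      geProj 0 (rightProd (factors w) p * Y * leftProd (factors w) p) * rightProd (factors w) p,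
    leftProd_zero, rightProd_zero, rightProd_length, leftProd_length, factorOp_eq]
  simp only [mul_one, one_mul]

theorem factorOp_commutator (w : Fin m → R) (a : R) :
    factorOp w * mulOp a - mulOp a * factorOp w =
      ∑ p : Fin m, leftProd (factors w) p * mulOp a′ * rightProd (factors w) (p + 1) := by
  have h := leibniz_prod_ofFn (AddMonoidHom.mulRight (mulOp a) - AddMonoidHom.mulLeft (mulOp a))
    (fun A B => by
      simp only [AddMonoidHom.sub_apply, AddMonoidHom.coe_mulRight, AddMonoidHom.coe_mulLeft]
      noncomm_ring) (factors w)
  -- Each factor sees only a′; hence constants, and so the choice of D⁻¹, do not matter.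
  have hp (p : Fin m) : factors w p * mulOp a - mulOp a * factors w p = mulOp a′ := by
    rw [factors, sub_mul, mul_sub, dpow_one_mul_mulOp, mulOp_mul_mulOp, mulOp_mul_mulOp, mul_comm a]
    abel
  simp only [AddMonoidHom.sub_apply, AddMonoidHom.coe_mulRight, AddMonoidHom.coe_mulLeft, hp] at h
  exact h

/-- At order 0 the conjugate has coefficient Q_0 + Q_1′: the truncation Q_{≥1} accounts for Q_1′,
and Q_0 has to be added back. -/
theorem geProj_zero_conj (Q : PDO R) :
    geProj 0 (dpow 1 * Q * dpow (-1)) = dpow 1 * geProj 1 Q * dpow (-1) + zeroProj Q := by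
  ext i
  simp only [coeff_geProj, coeff_add, coeff_mul_dpow, coeff_dpow_one_mul, zeroProj, coeff_mulOp]
  rcases lt_trichotomy i 0 with h | h | h
  · rw [if_neg (by omega), if_neg (by omega), if_neg (by omega), if_neg (by omega)]
    simp
  · subst h
    simp [add_comm]
  · rw [if_pos (by omega), if_pos (by omega), if_pos (by omega), if_neg (by omega)]
    simp

theorem poissonWith_factorOp (w : Fin m → R) (X : PDO R) (g : R)
    (hg : g′ = res (X * (factorOp w * dpow 1) - factorOp w * dpow 1 * X)) :
    poissonWith (factorOp w * dpow 1) X g =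
      -(∑ p : Fin m, leftProd (factors w) p *
        mulOp ((splitRes w (dpow 1 * X) p)′ + (∑ q, splitRes w (dpow 1 * X) q)′) *
          rightProd (factors w) (p + 1)) * dpow 1 := by
  have hd : (dpow 1 * dpow (-1) : PDO R) = 1 := dpow_mul_dpow _ _
  have hd' : (dpow (-1) * dpow 1 : PDO R) = 1 := dpow_mul_dpow _ _
  have hS := deriv_sum_splitRes w (dpow 1 * X)
  have hK := factorOp_adler w (dpow 1 * X)
  set S := ∑ q, splitRes w (dpow 1 * X) q with hSdef
  have hYΛ : dpow 1 * X * factorOp w = dpow 1 * (X * (factorOp w * dpow 1)) * dpow (-1) := by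
    simp only [mul_assoc, hd, mul_one]
  set Q := X * (factorOp w * dpow 1) with hQ
  -- Here S′ = res(LX) - res(YΛ), res(YΛ) = res Q + Q_0′ and g′ = res Q - res(LX). So S + Q_0 + g
  -- commutes with Λ, and [Λ, Q_0 + g] can be traded for -[Λ, S].
  have hk : (S + Q.coeff 0 + g)′ = 0 := by
    rw [map_add, map_add, hS, hg, hYΛ, res_sub, res, res, res, res, coeff_mul_dpow,
      coeff_dpow_one_mul, mul_assoc]
    norm_num
    ring
  have hcomm := factorOp_commutator w (S + Q.coeff 0 + g)
  rw [hk] at hcomm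
  simp only [mulOp_zero, mul_zero, zero_mul, Finset.sum_const_zero, mulOp_add] at hcomm
  have hSc := factorOp_commutator w S
  simp only [mulOp_add, mul_add, add_mul, Finset.sum_add_distrib]
  rw [← hSc, ← neg_neg (∑ p : Fin m, leftProd (factors w) p *
    mulOp (splitRes w (dpow 1 * X) p)′ * rightProd (factors w) (p + 1)), ← hK, hYΛ,
    geProj_zero_conj, poissonWith, ← hQ, ← hg]
  -- The term Λg′ produced by moving ∂ past g cancels the summand L∂⁻¹ res[X, L] of the tensor.
  have hLg : factorOp w * dpow 1 * mulOp g =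
      factorOp w * mulOp g * dpow 1 + factorOp w * mulOp g′ := by
    rw [mul_assoc, dpow_one_mul_mulOp, mul_add, mul_assoc]
  have hc : factorOp w * dpow 1 * (dpow (-1) * mulOp g′) = factorOp w * mulOp g′ := by
    rw [mul_assoc, ← mul_assoc (dpow 1), hd, one_mul]
  have hq : dpow 1 * geProj 1 Q * dpow (-1) * dpow 1 = dpow 1 * geProj 1 Q := by
    rw [mul_assoc, hd', mul_one]
  have hcomm' := congrArg (· * (dpow 1 : PDO R)) hcomm
  simp only [zeroProj, sub_mul, mul_add, add_mul, zero_mul, neg_mul] at hcomm' ⊢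
  rw [hLg, hc]
  have hq' : factorOp w * (dpow 1 * geProj 1 Q * dpow (-1)) * dpow 1 =
      factorOp w * dpow 1 * geProj 1 Q := by rw [mul_assoc, hq, mul_assoc]
  simp only [neg_sub, hq', neg_add] at hcomm' ⊢
  rw [← sub_eq_zero, ← hcomm']
  simp only [mul_assoc]
  abel

end PDO

/-! ### Maps acting on coefficients. -/

namespace PDO

variable {R S : Type*} [CommRing R] [CommRing S]

/-- Application of an additive map to all coefficients. -/
def mapCoeff (φ : R →+ S) : PDO R →+ PDO S where
  toFun A := ⟨fun i => φ (A.coeff i), by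
    obtain ⟨N, hN⟩ := A.2
    exact ⟨N, fun i hi => (congrArg φ (hN i hi)).trans (map_zero φ)⟩⟩
  map_zero' := by ext i; exact map_zero φ
  map_add' A B := by ext i; exact map_add φ _ _

theorem coeff_mapCoeff (φ : R →+ S) (A : PDO R) (i : ℤ) :
    (mapCoeff φ A).coeff i = φ (A.coeff i) := rfl

theorem mapCoeff_monomial (φ : R →+ S) (k : ℤ) (a : R) :
    mapCoeff φ (monomial k a) = monomial k (φ a) := by
  ext i; rw [coeff_mapCoeff, coeff_monomial, coeff_monomial, apply_ite φ, map_zero]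

theorem mapCoeff_mulOp (φ : R →+ S) (a : R) : mapCoeff φ (mulOp a) = mulOp (φ a) :=
  mapCoeff_monomial φ 0 a

theorem mapCoeff_zeroProj (φ : R →+ S) (A : PDO R) :
    mapCoeff φ (zeroProj A) = zeroProj (mapCoeff φ A) := mapCoeff_mulOp φ _

theorem mapCoeff_geProj (φ : R →+ S) (k : ℤ) (A : PDO R) :
    mapCoeff φ (geProj k A) = geProj k (mapCoeff φ A) := by
  ext i; rw [coeff_mapCoeff, coeff_geProj, coeff_geProj, apply_ite φ, map_zero, coeff_mapCoeff]

variable [Differential R] [Differential S]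

/-- Application of a homomorphism of differential rings to all coefficients. -/
def mapRingHom (φ : R →+* S) (hφ : ∀ a, φ a′ = (φ a)′) : PDO R →+* PDO S where
  __ := mapCoeff φ.toAddMonoidHom
  map_one' := (mapCoeff_mulOp φ.toAddMonoidHom 1).trans (congrArg mulOp (map_one φ))
  map_mul' A B := by
    have hi (k : ℕ) : Function.Semiconj φ _ _ := Function.Semiconj.iterate_right (f := φ) hφ k
    ext m
    change φ.toAddMonoidHom ((A * B).coeff m) = _
    rw [coeff_mul, coeff_mul, AddMonoidHom.map_finsum _ (finite_support_mul A B m)]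
    refine finsum_congr fun p => ?_
    rw [map_zsmul]
    exact congrArg _ ((map_mul φ _ _).trans (congrArg _ (hi p.2 _)))

section MapRingHom

variable (φ : R →+* S) (hφ : ∀ a, φ a′ = (φ a)′)

theorem mapRingHom_mulOp (a : R) : mapRingHom φ hφ (mulOp a) = mulOp (φ a) :=
  mapCoeff_mulOp φ.toAddMonoidHom a

theorem mapRingHom_dpow (k : ℤ) : mapRingHom φ hφ (dpow k) = dpow k :=
  (mapCoeff_monomial φ.toAddMonoidHom k 1).trans (congrArg (monomial k) (map_one φ))

theorem res_mapRingHom (A : PDO R) : res (mapRingHom φ hφ A) = φ (res A) := rfl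

theorem mapRingHom_laxOp {m : ℕ} (v : Fin m → R) :
    mapRingHom φ hφ (laxOp v) = laxOp fun i => φ (v i) := by
  simp only [laxOp, map_add, map_sum, map_mul, mapRingHom_mulOp, mapRingHom_dpow]

theorem mapRingHom_gradOp {m : ℕ} (ξ : Fin m → R) :
    mapRingHom φ hφ (gradOp ξ) = gradOp fun i => φ (ξ i) := by
  simp only [gradOp, map_sum, map_mul, mapRingHom_mulOp, mapRingHom_dpow]

theorem mapRingHom_poissonWith (L X : PDO R) (g : R) :
    mapRingHom φ hφ (poissonWith L X g) =
      poissonWith (mapRingHom φ hφ L) (mapRingHom φ hφ X) (φ g) := by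
  have h1 (k : ℤ) (A : PDO R) : mapRingHom φ hφ (geProj k A) = geProj k (mapRingHom φ hφ A) :=
    mapCoeff_geProj φ.toAddMonoidHom k A
  have h2 (A : PDO R) : mapRingHom φ hφ (zeroProj A) = zeroProj (mapRingHom φ hφ A) :=
    mapCoeff_zeroProj φ.toAddMonoidHom A
  simp only [poissonWith, map_sub, map_mul, mapRingHom_mulOp, mapRingHom_dpow, h1, h2,
    ← res_mapRingHom φ hφ]

end MapRingHom

/-- Commuting with the derivation, δ passes through the derivatives in the composition formula. For
evolutionary δ this allows differentiating Λ factor by factor. -/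
theorem mapCoeff_leibniz (δ : R →+ R) (hδ : ∀ a b, δ (a * b) = δ a * b + a * δ b)
    (hc : ∀ a, δ a′ = (δ a)′) (A B : PDO R) :
    mapCoeff δ (A * B) = mapCoeff δ A * B + A * mapCoeff δ B := by
  have hi (k : ℕ) : Function.Semiconj δ _ _ := Function.Semiconj.iterate_right (f := δ) hc k
  ext m
  rw [coeff_mapCoeff, coeff_add, coeff_mul, coeff_mul, coeff_mul,
    AddMonoidHom.map_finsum _ (finite_support_mul A B m),
    ← finsum_add_distrib (finite_support_mul _ _ m) (finite_support_mul _ _ m)]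
  refine finsum_congr fun p => ?_
  rw [map_zsmul, hδ, smul_add, hi]
  rfl

end PDO

/-! ### The chain rule for derivations of polynomials. -/

section ChainRule

open MvPolynomial

theorem derivation_algHom_apply {K σ B : Type*} [CommRing K] [CommRing B] [Algebra K B]
    (φ : MvPolynomial σ K →ₐ[K] B) (D : Derivation K B B) {f : MvPolynomial σ K}
    {s : Finset σ} (hs : f.vars ⊆ s) :
    D (φ f) = ∑ p ∈ s, φ (pderiv p f) * D (φ (X p)) := by
  classical
  -- Induction inside the subalgebra on s keeps the index set of the sum fixed.
  have hf : f ∈ Algebra.adjoin K (X '' (s : Set σ)) := mem_supported.2 (Finset.coe_subset.2 hs)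
  clear hs
  induction hf using Algebra.adjoin_induction with
  | mem x hx =>
    obtain ⟨q, hq, rfl⟩ := hx
    rw [Finset.sum_eq_single_of_mem q hq]
    · simp
    · intro p _ hp
      rw [pderiv_X_of_ne hp.symm, map_zero, zero_mul]
  | algebraMap r =>
    rw [AlgHom.commutes, Derivation.map_algebraMap, Finset.sum_eq_zero]
    intro p _
    rw [Derivation.map_algebraMap, map_zero, zero_mul]
  | add f g _ _ hf hg =>
    rw [map_add, map_add, hf, hg, ← Finset.sum_add_distrib]
    exact Finset.sum_congr rfl fun p _ => by rw [map_add, map_add, add_mul]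
  | mul f g _ _ hf hg =>
    rw [map_mul, Derivation.leibniz, hf, hg, smul_eq_mul, smul_eq_mul, Finset.mul_sum,
      Finset.mul_sum, ← Finset.sum_add_distrib]
    refine Finset.sum_congr rfl fun p _ => ?_
    rw [pderiv_mul, map_add, map_mul, map_mul]
    ring

end ChainRule

/-! ### Formal variational calculus. -/

section VariationalCalculus

open MvPolynomial

variable {K ι : Type*} [CommRing K]

theorem deriv_eq_totalD (f : DiffPoly K ι) : f′ = totalD K ι f := rfl

theorem totalD_X (p : ι × ℕ) : totalD K ι (X p) = X (p.1, p.2 + 1) := mkDerivation_X _ _ _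

theorem exists_forall_mem_vars_lt (f : DiffPoly K ι) : ∃ N, ∀ p ∈ f.vars, p.2 < N :=
  ⟨f.vars.sup Prod.snd + 1, fun _ hp => Nat.lt_succ_of_le (Finset.le_sup (f := Prod.snd) hp)⟩

theorem pderiv_eq_zero_of_le {f : DiffPoly K ι} {N : ℕ} (hN : ∀ p ∈ f.vars, p.2 < N) (i : ι)
    {k : ℕ} (hk : N ≤ k) : pderiv (i, k) f = 0 :=
  pderiv_eq_zero_of_notMem_vars fun h => absurd (hN _ h) (by simpa using hk)

theorem finsum_pderiv {f : DiffPoly K ι} {N : ℕ} (hN : ∀ p ∈ f.vars, p.2 < N) (i : ι)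
    (G : ℕ → DiffPoly K ι → DiffPoly K ι) (hG : ∀ k, G k 0 = 0) :
    ∑ᶠ k : ℕ, G k (pderiv (i, k) f) = ∑ k ∈ Finset.range N, G k (pderiv (i, k) f) := by
  refine finsum_eq_sum_of_support_subset _ fun k hk => ?_
  rw [Finset.mem_coe, Finset.mem_range]
  by_contra! h
  exact hk (by simp only [pderiv_eq_zero_of_le hN i h, hG])

theorem iterate_totalD_zero (k : ℕ) : (totalD K ι)^[k] 0 = 0 := iterate_map_zero _ k

theorem pderiv_comm (p q : ι × ℕ) (f : DiffPoly K ι) :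
    pderiv p (pderiv q f) = pderiv q (pderiv p f) := by
  classical
  have h : ⁅pderiv (R := K) p, pderiv (R := K) q⁆ = 0 := by
    refine derivation_ext fun r => ?_
    rw [Derivation.commutator_apply, pderiv_X, pderiv_X, Pi.single_apply, Pi.single_apply,
      apply_ite (pderiv p), apply_ite (pderiv q)]
    simp
  have h' := DFunLike.congr_fun h f
  rwa [Derivation.commutator_apply, Derivation.zero_apply, sub_eq_zero] at h'

theorem toFunctional_totalD (f : DiffPoly K ι) : toFunctional (totalD K ι f) = 0 :=
  (Submodule.Quotient.mk_eq_zero _).2 ⟨f, rfl⟩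

theorem toFunctional_eq_iff {f g : DiffPoly K ι} :
    toFunctional f = toFunctional g ↔ ∃ h, totalD K ι h = f - g :=
  Submodule.Quotient.eq _

theorem toFunctional_mul_iterate_totalD (k : ℕ) (a b : DiffPoly K ι) :
    toFunctional (a * (totalD K ι)^[k] b) =
      toFunctional ((-1) ^ k * (totalD K ι)^[k] a * b) := by
  induction k generalizing a with
  | zero => simp
  | succ k ih =>
    have h : toFunctional (a * (totalD K ι)^[k + 1] b) =
        -toFunctional (totalD K ι a * (totalD K ι)^[k] b) := by
      rw [← add_eq_zero_iff_eq_neg, ← map_add, ← toFunctional_totalD (a * (totalD K ι)^[k] b),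
        Derivation.leibniz, Function.iterate_succ_apply', smul_eq_mul, smul_eq_mul,
        mul_comm (totalD K ι a)]
    rw [h, ih, ← map_neg, Function.iterate_succ_apply]
    congr 1
    ring

theorem aeval_totalD {κ : Type*} (u : ι → DiffPoly K κ) (f : DiffPoly K ι) :
    aeval (fun p : ι × ℕ => (totalD K κ)^[p.2] (u p.1)) (totalD K ι f) =
      totalD K κ (aeval (fun p : ι × ℕ => (totalD K κ)^[p.2] (u p.1)) f) := by
  induction f using MvPolynomial.induction_on with
  | C a => rw [derivation_C, map_zero, algHom_C, algebraMap_eq, derivation_C]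
  | add f g hf hg => rw [map_add, map_add, hf, hg, map_add, map_add]
  | mul_X f p hf =>
    rw [Derivation.leibniz, map_mul, Derivation.leibniz, map_add, smul_eq_mul, smul_eq_mul, map_mul,
      map_mul, hf, totalD_X, aeval_X, aeval_X, smul_eq_mul, smul_eq_mul,
      Function.iterate_succ_apply']

variable [DecidableEq ι]

theorem varDeriv_eq_sum {f : DiffPoly K ι} {N : ℕ} (hN : ∀ p ∈ f.vars, p.2 < N) (i : ι) :
    varDeriv f i = ∑ k ∈ Finset.range N, (-1) ^ k * (totalD K ι)^[k] (pderiv (i, k) f) :=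
  finsum_pderiv hN i (fun k a => (-1) ^ k * (totalD K ι)^[k] a)
    (fun k => by rw [iterate_totalD_zero, mul_zero])

theorem frechet_eq_sum {f : DiffPoly K ι} {N : ℕ} (hN : ∀ p ∈ f.vars, p.2 < N) (i : ι)
    (η : DiffPoly K ι) :
    frechet f i η = ∑ k ∈ Finset.range N, pderiv (i, k) f * (totalD K ι)^[k] η :=
  finsum_pderiv hN i (fun k a => a * (totalD K ι)^[k] η) (fun _ => zero_mul _)

theorem frechetAdj_eq_sum {f : DiffPoly K ι} {N : ℕ} (hN : ∀ p ∈ f.vars, p.2 < N) (i : ι)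
    (ξ : DiffPoly K ι) :
    frechetAdj f i ξ =
      ∑ k ∈ Finset.range N, (-1) ^ k * (totalD K ι)^[k] (pderiv (i, k) f * ξ) :=
  finsum_pderiv hN i (fun k a => (-1) ^ k * (totalD K ι)^[k] (a * ξ))
    (fun k => by rw [zero_mul, iterate_totalD_zero, mul_zero])

theorem varDeriv_eq_frechetAdj (f : DiffPoly K ι) (i : ι) : varDeriv f i = frechetAdj f i 1 := by
  simp only [varDeriv, frechetAdj, mul_one]

/-- The evolutionary derivation with `u_i ↦ η` and all other fields fixed. -/
def frechetDer (i : ι) (η : DiffPoly K ι) : Derivation K (DiffPoly K ι) (DiffPoly K ι) :=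
  mkDerivation K fun p => if p.1 = i then (totalD K ι)^[p.2] η else 0

theorem frechetDer_X (i : ι) (η : DiffPoly K ι) (p : ι × ℕ) :
    frechetDer i η (X p) = if p.1 = i then (totalD K ι)^[p.2] η else 0 := mkDerivation_X _ _ _

theorem frechetDer_apply [Fintype ι] (i : ι) (η f : DiffPoly K ι) :
    frechetDer i η f = frechet f i η := by
  obtain ⟨N, hN⟩ := exists_forall_mem_vars_lt f
  have h := derivation_algHom_apply (AlgHom.id K _) (frechetDer i η) (f := f)
    (s := Finset.univ ×ˢ Finset.range N) (fun p hp => by simpa using hN p hp)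
  rw [frechet_eq_sum hN, ← AlgHom.id_apply (R := K) f, h, Finset.sum_product,
    Finset.sum_eq_single i]
  · simp [frechetDer_X]
  · intro j _ hj
    simp [frechetDer_X, hj]
  · simp

theorem frechetDer_totalD (i : ι) (η f : DiffPoly K ι) :
    frechetDer i η (totalD K ι f) = totalD K ι (frechetDer i η f) := by
  have h : ⁅frechetDer i η, totalD K ι⁆ = 0 := by
    refine derivation_ext fun p => ?_
    rw [Derivation.commutator_apply, totalD_X, frechetDer_X, frechetDer_X, Derivation.zero_apply]
    split_ifs
    · rw [Function.iterate_succ_apply', sub_self]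
    · rw [map_zero, sub_self]
  have h' := DFunLike.congr_fun h f
  rwa [Derivation.commutator_apply, Derivation.zero_apply, sub_eq_zero] at h'

/-- Derivations are determined on variables, and there [∂/∂u^{(k+1)}, D] = ∂/∂u^{(k)}. -/
theorem pderiv_succ_totalD (i : ι) (k : ℕ) (f : DiffPoly K ι) :
    pderiv (i, k + 1) (totalD K ι f) = totalD K ι (pderiv (i, k + 1) f) + pderiv (i, k) f := by
  have h : ⁅pderiv (R := K) (i, k + 1), totalD K ι⁆ = pderiv (i, k) := by
    refine derivation_ext fun p => ?_
    rw [Derivation.commutator_apply, totalD_X, pderiv_X, pderiv_X, pderiv_X, Pi.single_apply,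
      Pi.single_apply, Pi.single_apply, apply_ite (totalD K ι), Derivation.map_one_eq_zero,
      map_zero, ite_self, sub_zero]
    exact if_congr (by simp [Prod.ext_iff]) rfl rfl
  have h' := DFunLike.congr_fun h f
  rw [Derivation.commutator_apply] at h'
  rw [← h', add_sub_cancel]

/-! ### Integration by parts -/

theorem toFunctional_mul_frechet (a f : DiffPoly K ι) (i : ι) (η : DiffPoly K ι) :
    toFunctional (a * frechet f i η) = toFunctional (frechetAdj f i a * η) := by
  obtain ⟨N, hN⟩ := exists_forall_mem_vars_lt f
  rw [frechet_eq_sum hN, frechetAdj_eq_sum hN, Finset.mul_sum, Finset.sum_mul, map_sum, map_sum]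
  refine Finset.sum_congr rfl fun k _ => ?_
  rw [← mul_assoc, toFunctional_mul_iterate_totalD, mul_comm a]

/-- A differential polynomial is determined by the functionals `η ↦ ∫ a η dx`. -/
theorem eq_of_toFunctional_mul_eq {K : Type*} [Field K] [CharZero K] (i : ι) {a b : DiffPoly K ι}
    (hab : ∀ η, toFunctional (a * η) = toFunctional (b * η)) : a = b := by
  obtain ⟨N, hN⟩ := exists_forall_mem_vars_lt (a - b)
  -- A total derivative is linear in its highest derivative. The test function is quadratic in
  -- u^{(N+1)}, which is beyond all variables of a - b.
  obtain ⟨h, hh⟩ := toFunctional_eq_iff.1 (hab (X (i, N + 1) ^ 2))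
  obtain ⟨M, hM⟩ := exists_forall_mem_vars_lt h
  rw [← sub_mul] at hh
  have hX {k : ℕ} (hk : N < k) : pderiv (i, k) (totalD K ι h) =
      (a - b) * (2 * X (i, N + 1) * pderiv (i, k) (X (i, N + 1))) := by
    rw [hh, pderiv_mul, pderiv_eq_zero_of_le hN i hk.le, pderiv_pow]
    push_cast
    ring
  -- Descending induction from the order M of h: h involves no u_i^{(k)} with k > N.
  have hh0 : ∀ j k, N < k → M ≤ k + j → pderiv (i, k) h = 0 := by
    intro j
    induction j with
    | zero => exact fun k _ hk => pderiv_eq_zero_of_le hM i hk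
    | succ j ih =>
      intro k hk hkM
      have h1 := hX (k := k + 1) (by omega)
      rw [pderiv_succ_totalD, ih (k + 1) (by omega) (by omega), map_zero, zero_add,
        pderiv_X_of_ne fun h' => (show N ≠ k by omega) (by simpa using h'), mul_zero,
          mul_zero] at h1
      exact h1
  -- This reads ∂h/∂u^{(N)} = 2(a - b)u^{(N+1)}; applying ∂/∂u^{(N+1)} kills the left side and
  -- leaves 2(a - b) = 0.
  have h1 := hX (k := N + 1) (by omega)
  rw [pderiv_succ_totalD, hh0 M (N + 1) (by omega) (by omega), map_zero, zero_add, pderiv_X_self,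
    mul_one] at h1
  have h2 := congrArg (pderiv (i, N + 1)) h1
  rw [pderiv_comm (i, N + 1), hh0 M (N + 1) (by omega) (by omega), map_zero, pderiv_mul,
    pderiv_eq_zero_of_le hN i (Nat.le_succ N), pderiv_mul, pderiv_X_self,
    show (2 : DiffPoly K ι) = C 2 from (map_ofNat C 2).symm, pderiv_C] at h2
  have h3 : (a - b) * C 2 = 0 := by rw [h2]; ring
  rw [mul_eq_zero, sub_eq_zero, C_eq_zero] at h3
  exact h3.resolve_right two_ne_zero

/-- The chain rule for variational derivatives. -/
theorem varDeriv_aeval {K ι κ : Type*} [Field K] [CharZero K] [Fintype ι] [DecidableEq ι]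
    [Fintype κ] [DecidableEq κ] (u : ι → DiffPoly K κ) (f : DiffPoly K ι) (k : κ) :
    varDeriv (aeval (fun p : ι × ℕ => (totalD K κ)^[p.2] (u p.1)) f) k =
      ∑ l, frechetAdj (u l) k
        (aeval (fun p : ι × ℕ => (totalD K κ)^[p.2] (u p.1)) (varDeriv f l)) := by
  set φ : DiffPoly K ι →ₐ[K] DiffPoly K κ :=
    aeval (fun p : ι × ℕ => (totalD K κ)^[p.2] (u p.1)) with hφ
  have hφD (j : ℕ) (a : DiffPoly K ι) : φ ((totalD K ι)^[j] a) = (totalD K κ)^[j] (φ a) :=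
    Function.Semiconj.iterate_right (f := φ) (aeval_totalD u) j a
  -- Tested against η, both sides become the integral of the variation of the substituted density,
  -- by the ordinary chain rule and integration by parts.
  refine eq_of_toFunctional_mul_eq k fun η => ?_
  have hD (j : ℕ) (a : DiffPoly K κ) :
      frechetDer k η ((totalD K κ)^[j] a) = (totalD K κ)^[j] (frechetDer k η a) :=
    Function.Semiconj.iterate_right (f := frechetDer k η) (frechetDer_totalD k η) j a
  obtain ⟨N, hN⟩ := exists_forall_mem_vars_lt f
  rw [varDeriv_eq_frechetAdj, ← toFunctional_mul_frechet, one_mul, ← frechetDer_apply,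
    derivation_algHom_apply φ (frechetDer k η) (s := Finset.univ ×ˢ Finset.range N)
      (fun p hp => by simpa using hN p hp), Finset.sum_product, Finset.sum_mul, map_sum, map_sum]
  refine Finset.sum_congr rfl fun l _ => ?_
  rw [← toFunctional_mul_frechet, ← frechetDer_apply, varDeriv_eq_sum hN, map_sum φ, Finset.sum_mul,
    map_sum, map_sum]
  refine Finset.sum_congr rfl fun j _ => ?_
  rw [hφ, aeval_X, ← hφ, hD, toFunctional_mul_iterate_totalD, map_mul φ, hφD, map_pow, map_neg,
    map_one]

end VariationalCalculus

/-! ### Coefficients of the Lax operator and the residue pairing. -/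

namespace PDO

section LaxOperator

variable {R : Type*} [CommRing R] [Differential R] {m : ℕ}

theorem prod_ofFn_firstOrder (c : Fin m → R) :
    IsDifferential (List.ofFn fun p => dpow 1 - mulOp (c p)).prod ∧
      OrderLE m (List.ofFn fun p => dpow 1 - mulOp (c p)).prod ∧
      (List.ofFn fun p => dpow 1 - mulOp (c p)).prod.coeff m = 1 := by
  induction m with
  | zero =>
    rw [List.ofFn_zero, List.prod_nil, one_eq_mulOp]
    exact ⟨isDifferential_monomial le_rfl 1, orderLE_monomial 0 1, by simp [coeff_mulOp]⟩
  | succ m ih =>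
    obtain ⟨h1, h2, h3⟩ := ih fun p => c p.succ
    rw [List.ofFn_succ, List.prod_cons]
    refine ⟨((isDifferential_monomial zero_le_one 1).sub
      (isDifferential_monomial le_rfl _)).mul h1, ?_, ?_⟩
    · have h := ((orderLE_monomial 1 (1 : R)).sub
        ((orderLE_monomial 0 (c 0)).mono zero_le_one)).mul h2
      exact h.mono (by push_cast; omega)
    · rw [sub_mul, coeff_sub, coeff_dpow_one_mul, coeff_mulOp_mul,
        h2 ((m + 1 : ℕ) : ℤ) (by push_cast; omega), map_zero, mul_zero, sub_zero, add_zero,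
        Nat.cast_succ, add_sub_cancel_right, h3]

theorem coeff_sum_mulOp_mul_dpow (a : Fin m → R) (j : ℤ) :
    (∑ i : Fin m, mulOp (a i) * dpow (i : ℤ)).coeff j = ∑ i : Fin m, if j = i then a i else 0 := by
  rw [coeff_sum]
  simp only [mulOp_mul_dpow, coeff_monomial]

/-- The product is a monic differential operator of order m. -/
theorem factorOp_eq_sum (w : Fin m → R) :
    factorOp w = dpow m + ∑ i : Fin m, mulOp ((factorOp w).coeff i) * dpow (i : ℤ) := by
  obtain ⟨h1, h2, h3⟩ := prod_ofFn_firstOrder fun p => w p.rev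
  rw [← factorOp] at h1 h2 h3
  ext j
  rw [coeff_add, coeff_dpow, coeff_sum_mulOp_mul_dpow]
  rcases lt_or_ge j 0 with hj | hj
  · rw [h1 j hj, if_neg (by omega), Finset.sum_eq_zero fun i _ => if_neg (by omega), add_zero]
  obtain ⟨k, rfl⟩ := Int.eq_ofNat_of_zero_le hj
  rcases lt_trichotomy k m with hk | rfl | hk
  · rw [if_neg (by omega), Finset.sum_eq_single (⟨k, hk⟩ : Fin m), if_pos rfl, zero_add]
    · intro i _ hi
      exact if_neg fun h => hi (Fin.ext (by simpa using h.symm))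
    · simp
  · rw [if_pos rfl, Finset.sum_eq_zero fun i _ => if_neg (by omega), add_zero, h3]
  · rw [if_neg (by omega), Finset.sum_eq_zero fun i _ => if_neg (by omega), add_zero,
      h2 _ (by omega)]

theorem laxOp_eq_mul_dpow_one (v : Fin m → R) :
    laxOp v = (dpow m + ∑ i : Fin m, mulOp (v i) * dpow (i : ℤ)) * dpow 1 := by
  rw [laxOp, add_mul, Finset.sum_mul, dpow_mul_dpow]
  simp only [mul_assoc, dpow_mul_dpow]

theorem mapCoeff_factorOp (δ : R →+ R) (hδ : δ 1 = 0) (w : Fin m → R) :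
    mapCoeff δ (factorOp w) =
      ∑ i : Fin m, mulOp (δ ((factorOp w).coeff i)) * dpow (i : ℤ) := by
  conv_lhs => rw [factorOp_eq_sum w]
  rw [map_add, map_sum, dpow, mapCoeff_monomial, hδ, monomial_zero, zero_add]
  simp only [mulOp_mul_dpow, mapCoeff_monomial]

theorem rightProd_factors_mem_exactResidue (w : Fin m → R) (p : ℕ) :
    rightProd (factors w) p ∈ exactResidue R := by
  refine Subring.list_prod_mem _ fun A hA => ?_
  obtain ⟨q, rfl⟩ := (List.mem_ofFn' _ _).1 (List.mem_of_mem_drop hA)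
  exact sub_mem dpow_one_mem_exactResidue (mulOp_mem_exactResidue _)

theorem deriv_antideriv {f : R} (h : ∃ g : R, g′ = f) : (antideriv f)′ = f := by
  rw [antideriv, dif_pos h]
  exact h.choose_spec

end LaxOperator

section Pairing

variable {K ι : Type*} [CommRing K] {m : ℕ}

/-- For i < j the residue is a multiple of a^{(j-i)}, a total derivative; for i > j the order is
below -1. So the two families of monomials are dual modulo total derivatives. -/
theorem toFunctional_res_monomial (i j : ℕ) (a : DiffPoly K ι) :
    toFunctional (res (dpow (-((i : ℤ) + 2)) * mulOp a * dpow ((j : ℤ) + 1))) =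
      if i = j then toFunctional a else 0 := by
  rw [res, coeff_mul_dpow, dpow, mulOp, coeff_monomial_mul_monomial]
  rcases lt_trichotomy i j with h | rfl | h
  · obtain ⟨k, rfl⟩ := Nat.exists_eq_add_of_lt h
    rw [if_pos (by push_cast; omega), if_neg (by omega), one_mul,
      show (-((i : ℤ) + 2) + 0 - (-1 - (((i + k + 1 : ℕ) : ℤ) + 1))).toNat = k + 1 by
        push_cast; omega,
      map_zsmul, Function.iterate_succ_apply', deriv_eq_totalD, toFunctional_totalD, smul_zero]
  · rw [if_pos (by omega), if_pos rfl,
      show (-((i : ℤ) + 2) + 0 - (-1 - ((i : ℤ) + 1))).toNat = 0 by omega]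
    simp
  · rw [if_neg (by omega), if_neg (by omega), map_zero]

theorem toFunctional_res_gradOp_mul (ξ a : Fin m → DiffPoly K ι) :
    toFunctional (res (gradOp ξ * ∑ i : Fin m, mulOp (a i) * dpow ((i : ℤ) + 1))) =
      toFunctional (∑ i, ξ i * a i) := by
  have h (i j : Fin m) : dpow (-((i : ℤ) + 2)) * mulOp (ξ i) * (mulOp (a j) * dpow ((j : ℤ) + 1)) =
      dpow (-(((i : ℕ) : ℤ) + 2)) * mulOp (ξ i * a j) * dpow (((j : ℕ) : ℤ) + 1) := by
    rw [← mulOp_mul_mulOp]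
    simp only [mul_assoc]
  rw [gradOp, Finset.sum_mul_sum, res, coeff_sum, map_sum, map_sum]
  refine Finset.sum_congr rfl fun i _ => ?_
  rw [coeff_sum, map_sum, Finset.sum_eq_single i]
  · rw [h]
    exact (toFunctional_res_monomial _ _ _).trans (if_pos rfl)
  · intro j _ hj
    rw [h]
    exact (toFunctional_res_monomial _ _ _).trans (if_neg fun h => hj (Fin.ext h.symm))
  · simp

end Pairing

end PDO

/-! ### The Miura map and the transformed tensor. -/

section MiuraMap

open PDO

variable (K : Type*) {m : ℕ}

theorem laxOp_miura [CommRing K] :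
    laxOp (miura K) = factorOp (fieldVar : Fin m → DiffPoly K (Fin m)) * dpow 1 := by
  rw [laxOp_eq_mul_dpow_one, factorOp_eq_sum fieldVar]
  rfl

theorem laxOp_miura_mul_dpow [CommRing K] :
    laxOp (miura K) * dpow (-1) = factorOp (fieldVar : Fin m → DiffPoly K (Fin m)) := by
  have h : (dpow 1 * dpow (-1) : PDO (DiffPoly K (Fin m))) = 1 := dpow_mul_dpow 1 (-1)
  rw [laxOp_miura, mul_assoc, h, mul_one]

/-- The Fréchet derivative of the Lax operator in the direction of one of the fields `w`. -/
theorem sum_frechet_miura [CommRing K] (j : Fin m) (η : DiffPoly K (Fin m)) :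
    ∑ i : Fin m, mulOp (frechet (miura K i) j η) * dpow ((i : ℤ) + 1) =
      -(leftProd (factors fieldVar) j.rev * mulOp η * rightProd (factors fieldVar) (j.rev + 1)) *
        dpow 1 := by
  have hδ := mapCoeff_leibniz (frechetDer j η : DiffPoly K (Fin m) →+ DiffPoly K (Fin m))
    (fun a b => by
      change frechetDer j η (a * b) = frechetDer j η a * b + a * frechetDer j η b
      rw [Derivation.leibniz, smul_eq_mul, smul_eq_mul, add_comm, mul_comm b])
    (frechetDer_totalD j η)
  have h := leibniz_prod_ofFn _ hδ (factors fieldVar)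
  -- Only one factor contains w_j; it sits at position `j.rev`, since indices decrease from left to
  -- right.
  rw [← factorOp_eq, Finset.sum_eq_single j.rev] at h
  · have hf : mapCoeff (frechetDer j η : DiffPoly K (Fin m) →+ DiffPoly K (Fin m))
        (factors fieldVar j.rev) = -mulOp η := by
      rw [factors, map_sub, mapCoeff_mulOp, dpow, mapCoeff_monomial, Fin.rev_rev]
      change monomial 1 (frechetDer j η 1) - mulOp (frechetDer j η (fieldVar j)) = _
      rw [Derivation.map_one_eq_zero, monomial_zero, zero_sub, fieldVar, frechetDer_X, if_pos rfl]
      rfl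
    rw [hf, mul_neg, neg_mul, mapCoeff_factorOp _
      (show frechetDer j η 1 = 0 from Derivation.map_one_eq_zero _)] at h
    rw [← h, Finset.sum_mul]
    refine Finset.sum_congr rfl fun i _ => ?_
    rw [mul_assoc, dpow_mul_dpow, ← frechetDer_apply]
    rfl
  · intro p _ hp
    have hf : mapCoeff (frechetDer j η : DiffPoly K (Fin m) →+ DiffPoly K (Fin m))
        (factors fieldVar p) = 0 := by
      rw [factors, map_sub, mapCoeff_mulOp, dpow, mapCoeff_monomial]
      change monomial 1 (frechetDer j η 1) - mulOp (frechetDer j η (fieldVar p.rev)) = _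
      rw [Derivation.map_one_eq_zero, monomial_zero, zero_sub, fieldVar, frechetDer_X,
        if_neg fun h => hp (by rw [← h, Fin.rev_rev]), mulOp_zero, neg_zero]
    rw [hf, mul_zero, zero_mul]
  · simp

theorem modifiedTensor_eq [CommRing K] (y : Fin m → DiffPoly K (Fin m)) (j : Fin m) :
    modifiedTensor K y j = -(totalD K (Fin m) (y j) + ∑ k, totalD K (Fin m) (y k)) := by
  have h (k : Fin m) : couplingMatrix K m j k • totalD K (Fin m) (y k) =
      (if j = k then totalD K (Fin m) (y k) else 0) + totalD K (Fin m) (y k) := by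
    rw [couplingMatrix]
    split_ifs
    · rw [two_smul]
    · rw [one_smul, zero_add]
  rw [modifiedTensor, Finset.sum_congr rfl fun k _ => h k, Finset.sum_add_distrib,
    Finset.sum_ite_eq, if_pos (Finset.mem_univ j)]

variable [Field K] [CharZero K]

/-- The adjoint of the Fréchet derivative of the Miura map, in terms of residues. -/
theorem sum_frechetAdj_miura (ξ : Fin m → DiffPoly K (Fin m)) (k : Fin m) :
    ∑ l, frechetAdj (miura K l) k (ξ l) = -splitRes fieldVar (dpow 1 * gradOp ξ) k.rev := by
  refine eq_of_toFunctional_mul_eq k fun η => ?_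
  have h1 : toFunctional ((∑ l, frechetAdj (miura K l) k (ξ l)) * η) =
      toFunctional (∑ l, ξ l * frechet (miura K l) k η) := by
    rw [Finset.sum_mul, map_sum, map_sum]
    exact Finset.sum_congr rfl fun l _ => (toFunctional_mul_frechet _ _ _ _).symm
  rw [h1, ← toFunctional_res_gradOp_mul, sum_frechet_miura]
  -- Cyclicity of ∫ res: the block ηB∂ moves to the front of XAηB∂, after which η factors out of the
  -- residue.
  obtain ⟨g, hg⟩ := mul_mem (mul_mem (mulOp_mem_exactResidue η)
    (rightProd_factors_mem_exactResidue (fieldVar : Fin m → DiffPoly K (Fin m)) (k.rev + 1)))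
    dpow_one_mem_exactResidue (gradOp ξ * leftProd (factors fieldVar) k.rev)
  refine toFunctional_eq_iff.2 ⟨-g, ?_⟩
  rw [map_neg, ← deriv_eq_totalD, hg, res_sub, mul_assoc (mulOp η), mul_assoc (mulOp η),
    res_mulOp_mul, splitRes]
  have h2 : gradOp ξ * (-(leftProd (factors fieldVar) k.rev * mulOp η *
      rightProd (factors fieldVar) (k.rev + 1)) * dpow 1) =
      -(gradOp ξ * leftProd (factors fieldVar) k.rev * (mulOp η *
        (rightProd (factors fieldVar) (k.rev + 1) * dpow 1))) := by
    noncomm_ring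
  rw [h2, show ∀ A : PDO (DiffPoly K (Fin m)), res (-A) = -res A from fun A => rfl]
  simp only [mul_assoc]
  ring

theorem modifiedTensor_frechetAdj_miura (ξ : Fin m → DiffPoly K (Fin m)) (j : Fin m) :
    modifiedTensor K (fun k => ∑ l : Fin m, frechetAdj (miura K l) k (ξ l)) j =
      (splitRes fieldVar (dpow 1 * gradOp ξ) j.rev)′ +
        (∑ q, splitRes fieldVar (dpow 1 * gradOp ξ) q)′ := by
  have h : ∑ k : Fin m, totalD K (Fin m) (splitRes fieldVar (dpow 1 * gradOp ξ) k.rev) =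
      ∑ k, totalD K (Fin m) (splitRes fieldVar (dpow 1 * gradOp ξ) k) :=
    Equiv.sum_comp Fin.revPerm fun k =>
      totalD K (Fin m) (splitRes fieldVar (dpow 1 * gradOp ξ) k)
  simp only [modifiedTensor_eq, sum_frechetAdj_miura, map_neg, Finset.sum_neg_distrib, h,
    deriv_eq_totalD, map_sum]
  ring

/-- The Poisson tensor at the image of the Miura map. -/
theorem poissonWith_laxOp_miura (ξ : Fin m → DiffPoly K (Fin m)) (g : DiffPoly K (Fin m))
    (hg : g′ = res (gradOp ξ * laxOp (miura K) - laxOp (miura K) * gradOp ξ)) :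
    poissonWith (laxOp (miura K)) (gradOp ξ) g =
      ∑ i : Fin m, mulOp
        (∑ j : Fin m, frechet (miura K i) j
          (modifiedTensor K (fun k => ∑ l : Fin m, frechetAdj (miura K l) k (ξ l)) j)) *
        dpow (i + 1) := by
  rw [laxOp_miura] at hg ⊢
  rw [poissonWith_factorOp _ _ _ hg]
  simp only [mulOp_sum, Finset.sum_mul]
  rw [Finset.sum_comm]
  simp only [sum_frechet_miura]
  rw [← Finset.sum_mul, Finset.sum_neg_distrib]
  refine congrArg (fun A => -A * dpow 1) ?_
  simp only [modifiedTensor_frechetAdj_miura]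
  -- Fields and factor positions are numbered in opposite directions.
  exact (Equiv.sum_comp Fin.revPerm fun p : Fin m => leftProd (factors fieldVar) p *
    mulOp ((splitRes fieldVar (dpow 1 * gradOp ξ) p)′ +
      (∑ q, splitRes fieldVar (dpow 1 * gradOp ξ) q)′) *
        rightProd (factors fieldVar) (p + 1)).symm

theorem toFunctional_bracketDensity (f g : DiffPoly K (Fin m)) :
    toFunctional (miuraPullback K m (bracketDensity K f g)) =
      toFunctional (∑ i : Fin m, varDeriv (miuraPullback K m f) i *
        modifiedTensor K (varDeriv (miuraPullback K m g)) i) := by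
  have hφ (a : DiffPoly K (Fin m)) :
      (miuraPullback K m : DiffPoly K (Fin m) →+* DiffPoly K (Fin m)) a′ =
        ((miuraPullback K m : DiffPoly K (Fin m) →+* DiffPoly K (Fin m)) a)′ :=
    aeval_totalD (miura K) a
  have hfield (i : Fin m) :
      (miuraPullback K m : DiffPoly K (Fin m) →+* DiffPoly K (Fin m)) (fieldVar i) = miura K i :=
    MvPolynomial.aeval_X _ _
  have hvar (h : DiffPoly K (Fin m)) (k : Fin m) : varDeriv (miuraPullback K m h) k =
      ∑ l, frechetAdj (miura K l) k (miuraPullback K m (varDeriv h l)) :=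
    varDeriv_aeval (miura K) h k
  have hL := mapRingHom_laxOp _ hφ fieldVar
  simp only [hfield] at hL
  have hg := deriv_antideriv
    (laxOp_mem_exactResidue (fieldVar : Fin m → DiffPoly K (Fin m)) (gradOp (varDeriv g)))
  -- The antiderivative chosen in the fields v pulls back to some antiderivative in the fields w,
  -- which is enough because the tensor formula holds for every choice.
  have hg' := congrArg (miuraPullback K m : DiffPoly K (Fin m) →+* DiffPoly K (Fin m)) hg
  rw [hφ, ← res_mapRingHom _ hφ, map_sub, map_mul, map_mul, hL, mapRingHom_gradOp] at hg'
  have hP := poissonWith_laxOp_miura K _ _ hg'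
  have h1 := res_mapRingHom _ hφ (gradOp (varDeriv f) *
    poissonTensor (laxOp fieldVar) (gradOp (varDeriv g)))
  rw [map_mul, poissonTensor, mapRingHom_poissonWith, hL, mapRingHom_gradOp, mapRingHom_gradOp,
    hP] at h1
  rw [bracketDensity, poissonTensor]
  refine (congrArg toFunctional h1.symm).trans ?_
  rw [toFunctional_res_gradOp_mul]
  rw [show varDeriv (miuraPullback K m g) = _ from funext (hvar g)]
  simp only [Finset.mul_sum, hvar, Finset.sum_mul]
  rw [Finset.sum_comm, map_sum, map_sum]
  refine Finset.sum_congr rfl fun j _ => ?_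
  rw [map_sum, map_sum]
  exact Finset.sum_congr rfl fun l _ => toFunctional_mul_frechet _ _ _ _

end MiuraMap

end

theorem theorem2 (K : Type*) [Field K] [CharZero K] (m : ℕ) :
    -- the Miura map is the one given by the factorization of `L ∂⁻¹`
    laxOp (miura K) * PDO.dpow (-1) = factorOp (fieldVar : Fin m → DiffPoly K (Fin m)) ∧
    -- `D⁻¹ res [X, L]` makes sense in the fields `v`
    (∀ ξ : Fin m → DiffPoly K (Fin m), ∃ g : DiffPoly K (Fin m),
      g′ = PDO.res (gradOp ξ * laxOp fieldVar - laxOp fieldVar * gradOp ξ)) ∧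
    -- the tensor at `v = v(w)` is `J ∘ (-M ∂) ∘ J*`, with `J` the Fréchet derivative of `v(w)`,
    -- whichever antiderivative is taken for `D⁻¹ res [X, L]`
    (∀ ξ : Fin m → DiffPoly K (Fin m),
      (∃ g : DiffPoly K (Fin m),
        g′ = PDO.res (gradOp ξ * laxOp (miura K) - laxOp (miura K) * gradOp ξ)) ∧
      ∀ g : DiffPoly K (Fin m),
        g′ = PDO.res (gradOp ξ * laxOp (miura K) - laxOp (miura K) * gradOp ξ) →
        poissonWith (laxOp (miura K)) (gradOp ξ) g =
          ∑ i : Fin m, PDO.mulOp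
            (∑ j : Fin m, frechet (miura K i) j
              (modifiedTensor K (fun k => ∑ l : Fin m, frechetAdj (miura K l) k (ξ l)) j)) *
            PDO.dpow (i + 1)) ∧
    -- the bracket of functionals `F = ∫ f dx`, `G = ∫ g dx` in the fields `w`
    (∀ f g : DiffPoly K (Fin m),
      toFunctional (miuraPullback K m (bracketDensity K f g)) =
        toFunctional (∑ i : Fin m, varDeriv (miuraPullback K m f) i *
          modifiedTensor K (varDeriv (miuraPullback K m g)) i)) := by
  exact ⟨laxOp_miura_mul_dpow K, fun ξ => PDO.laxOp_mem_exactResidue _ _, fun ξ =>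
    ⟨PDO.laxOp_mem_exactResidue _ _, poissonWith_laxOp_miura K ξ⟩, toFunctional_bracketDensity K⟩
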